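/- Let $(M,d)$ be a complete separable metric space with a non-negative Radon (i.e. locally finite Borel) measure $m$. **Sobolev class.** For a continuous curve $\gamma:[0,1]\to M$ which is absolutely continuous (there is $h\in L^1(0,1)$ with $d(\gamma_s,\gamma_t)\le\int_s^t h$ for all $s<t$), let $|\dot\gamma_t|=\lim_{s\to t}\frac{d(\gamma_s,\gamma_t)}{|s-t|}$ (it exists for a.e. $t$) be its metric speed; $\int_0^1|\dot\gamma_t|^2\,dt:=+\infty$ if $\gamma$ is not absolutely continuous. A *test plan* is a Borel probability measure $\pi$ on $C([0,1],M)$ such that, for some constant $C(\pi)$, the law of $\gamma_t$ under $\pi$ is $\le C(\pi)\,m$ for every $t\in[0,1]$, and $\int\!\int_0^1|\dot\gamma_t|^2\,dt\,d\pi(\gamma)<\infty$. The class $S^2(M)$ is the vector space of all $f\in L^0(m)$ (measurable real functions modulo $m$-a.e. equality) for which there is a non-negative $G\in L^2(m)$ with $$\int|f(\gamma_1)-f(\gamma_0)|\,d\pi(\gamma)\le\int\!\int_0^1G(\gamma_t)\,|\dot\gamma_t|\,dt\,d\pi(\gamma)\qquad\text{for every test plan }\pi ,$$ and $|Df|$ denotes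 the $m$-a.e. minimal such $G$. **Modules.** An $L^\infty(m)$-module is a real Banach space $\mathscr M$ with a bilinear map $L^\infty(m)\times\mathscr M\to\mathscr M$, $(f,v)\mapsto fv$, such that $(fg)v=f(gv)$, $\mathbf 1v=v$, $\|fv\|\le\|f\|_{L^\infty}\|v\|$, and, for all sequences of measurable sets $A_n\subset M$: (locality) if $\chi_{A_n}v=0$ for all $n$, then $\chi_{\bigcup_nA_n}v=0$; (gluing) if $v_n\in\mathscr M$ satisfy $\chi_{A_i\cap A_j}v_i=\chi_{A_i\cap A_j}v_j$ for all $i,j$ and $\limsup_n\|\sum_{i\le n}\chi_{A_i}v_i\|<\infty$, then there is $v\in\mathscr M$ with $\chi_{A_i}v=\chi_{A_i}v_i$ for all $i$ and $\|v\|\le\liminf_n\|\sum_{i\le n}\chi_{A_i}v_i\|$. For $v,w\in\mathscr M$, "$v=w$ $m$-a.e. on $A$" means $\chi_A(v-w)=0$. **Theorem.** Let $\mathscr M$ be an $L^\infty(m)$-module and let $L:S^2(M)\to\mathscr M$ be a linear map such that, for some constant $C>0$, $$\|L(f)\|_{\mathscr M}\le C\Big(\int|Df|^2\,dm\Big)^{1/2}\qquad\text{for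 all } f\in S^2(M).$$ Then the following are equivalent. 1. (Leibniz rule) For all $f,g\in L^\infty(m)\cap S^2(M)$, $L(fg)=f\,L(g)+g\,L(f)$. 2. (Chain rule) For every $f\in S^2(M)$: $L(f)=0$ $m$-a.e. on $f^{-1}(N)$ for every Borel $N\subset\mathbb R$ of Lebesgue measure zero; and, for every open $I\subset\mathbb R$ with $m(f^{-1}(\mathbb R\setminus I))=0$ and every Lipschitz $\varphi:I\to\mathbb R$, $L(\varphi\circ f)=(\varphi'\circ f)\,L(f)$, where $\varphi'\circ f\in L^\infty(m)$ is defined arbitrarily on the preimage under $f$ of the set of points where $\varphi$ is not differentiable. 3. (Locality) For all $f,g\in S^2(M)$, $L(f)=L(g)$ $m$-a.e. on $\{f=g\}$. (Here $fg\in S^2(M)$ and $\varphi\circ f\in S^2(M)$ in the situations of 1 and 2.) -/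

import Mathlib

open MeasureTheory Filter Topology Set
open scoped ENNReal NNReal unitInterval

noncomputable section

/-! ### Test plans and the Sobolev class -/

/-- The space of continuous curves `[0,1] → M` (with the topology of uniform convergence) carries
its Borel σ-algebra. -/
instance curveMeasurableSpace {M : Type*} [TopologicalSpace M] : MeasurableSpace C(I, M) :=
  borel C(I, M)

instance curveBorelSpace {M : Type*} [TopologicalSpace M] : BorelSpace C(I, M) := ⟨rfl⟩

/-- `γ` is absolutely continuous: `d(γ_s, γ_t) ≤ ∫_s^t f` for all `s < t`, for some
`f ∈ L¹(0,1)`. -/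
def IsACCurve {M : Type*} [MetricSpace M] (γ : C(I, M)) : Prop :=
  ∃ f : ℝ → ℝ, IntervalIntegrable f volume 0 1 ∧
    ∀ s t : I, s < t → dist (γ s) (γ t) ≤ ∫ r in (s : ℝ)..(t : ℝ), f r

/-- The metric speed `|γ̇_t| = lim_{s → t} d(γ_s, γ_t) / |s - t|`. For absolutely continuous curves
the limit exists for a.e. `t`; it is written as an upper limit so as to be defined for all `t`. -/
def metricSpeed {M : Type*} [MetricSpace M] (γ : C(I, M)) (t : I) : ℝ≥0∞ :=
  limsup (fun s : I => edist (γ s) (γ t) / edist s t) (𝓝[≠] t)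

open Classical in
/-- `∫₀¹ |γ̇_t|² dt`, which is `+∞` by convention if `γ` is not absolutely continuous. -/
def curveEnergy {M : Type*} [MetricSpace M] (γ : C(I, M)) : ℝ≥0∞ :=
  if IsACCurve γ then ∫⁻ t : I, metricSpeed γ t ^ 2 else ∞

/-- Test plans: Borel probability measures on curves, of bounded compression and finite kinetic
energy. -/
structure IsTestPlan {M : Type*} [MetricSpace M] [MeasurableSpace M] (m : Measure M)
    (π : Measure C(I, M)) : Prop where
  isProbabilityMeasure : IsProbabilityMeasure π
  boundedCompression : ∃ C : ℝ≥0, ∀ t : I, π.map (fun γ => γ t) ≤ C • m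
  finiteEnergy : ∫⁻ γ, curveEnergy γ ∂π < ∞

/-- `G ∈ L²(m)`, `G ≥ 0`, satisfies
`∫ |f(γ₁) - f(γ₀)| dπ(γ) ≤ ∬₀¹ G(γ_t) |γ̇_t| dt dπ(γ)` for all test plans `π`. Both sides only depend
on the classes of `f` and `G` up to `m`-a.e. equality. -/
structure IsWeakUpperGradient {M : Type*} [MetricSpace M] [MeasurableSpace M] (m : Measure M)
    (f : M →ₘ[m] ℝ) (G : M → ℝ) : Prop where
  measurable : Measurable G
  nonneg : ∀ x, 0 ≤ G x
  memLp : MemLp G 2 m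
  le : ∀ π : Measure C(I, M), IsTestPlan m π →
    ∫⁻ γ, ‖f (γ 1) - f (γ 0)‖ₑ ∂π ≤
      ∫⁻ γ, (∫⁻ t : I, ENNReal.ofReal (G (γ t)) * metricSpeed γ t) ∂π

/-- `G` is minimal, in the `m`-a.e. sense, among the weak upper gradients of `f`. -/
def IsMinimalWeakUpperGradient {M : Type*} [MetricSpace M] [MeasurableSpace M] (m : Measure M)
    (f : M →ₘ[m] ℝ) (G : M → ℝ) : Prop :=
  IsWeakUpperGradient m f G ∧ ∀ G' : M → ℝ, IsWeakUpperGradient m f G' → G ≤ᵐ[m] G'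

open Classical in
/-- The minimal weak upper gradient `|Df|` of `f` (unique up to `m`-a.e. equality). -/
def minimalWeakUpperGradient {M : Type*} [MetricSpace M] [MeasurableSpace M] (m : Measure M)
    (f : M →ₘ[m] ℝ) : M → ℝ :=
  if h : ∃ G, IsMinimalWeakUpperGradient m f G then h.choose else 0

theorem IsTestPlan.ae_comp {M : Type*} [MetricSpace M] [MeasurableSpace M] [BorelSpace M]
    {m : Measure M} {π : Measure C(I, M)} (hπ : IsTestPlan m π) (t : I) {p : M → Prop}
    (hp : ∀ᵐ x ∂m, p x) : ∀ᵐ γ ∂π, p (γ t) := by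
  obtain ⟨C, hC⟩ := hπ.boundedCompression
  have hac : π.map (fun γ : C(I, M) => γ t) ≪ m :=
    Measure.absolutelyContinuous_of_le_smul (c := (C : ℝ≥0∞)) (by simpa using hC t)
  have hm : Measurable (fun γ : C(I, M) => γ t) :=
    (ContinuousEvalConst.continuous_eval_const t).measurable
  exact ae_of_ae_map hm.aemeasurable (hac.ae_le hp)

/-- The increment `f(γ₁) - f(γ₀)` is controlled by a combination of the increments of `g`, `h`. -/
theorem IsWeakUpperGradient.of_increment_le {M : Type*} [MetricSpace M] [MeasurableSpace M]
    [BorelSpace M] {m : Measure M} {f g h : M →ₘ[m] ℝ} {G H : M → ℝ}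
    (hg : IsWeakUpperGradient m g G) (hh : IsWeakUpperGradient m h H) (a b : ℝ≥0)
    (hfgh : ∀ π : Measure C(I, M), IsTestPlan m π → ∀ᵐ γ ∂π,
      ‖f (γ 1) - f (γ 0)‖ₑ ≤ a * ‖g (γ 1) - g (γ 0)‖ₑ + b * ‖h (γ 1) - h (γ 0)‖ₑ) :
    IsWeakUpperGradient m f (fun x => a * G x + b * H x) where
  measurable := (hg.measurable.const_mul _).add (hh.measurable.const_mul _)
  nonneg x := add_nonneg (mul_nonneg a.2 (hg.nonneg x)) (mul_nonneg b.2 (hh.nonneg x))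
  memLp := (hg.memLp.const_mul _).add (hh.memLp.const_mul _)
  le := by
    intro π hπ
    have hev : ∀ t : I, Measurable (fun γ : C(I, M) => γ t) := fun t =>
      (ContinuousEvalConst.continuous_eval_const t).measurable
    have hgm : Measurable (fun γ : C(I, M) => (a : ℝ≥0∞) * ‖g (γ 1) - g (γ 0)‖ₑ) :=
      (((g.measurable.comp (hev 1)).sub (g.measurable.comp (hev 0))).enorm).const_mul _
    calc ∫⁻ γ, ‖f (γ 1) - f (γ 0)‖ₑ ∂π
        ≤ ∫⁻ γ, (a * ‖g (γ 1) - g (γ 0)‖ₑ + b * ‖h (γ 1) - h (γ 0)‖ₑ) ∂π :=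
          lintegral_mono_ae (hfgh π hπ)
      _ = a * ∫⁻ γ, ‖g (γ 1) - g (γ 0)‖ₑ ∂π + b * ∫⁻ γ, ‖h (γ 1) - h (γ 0)‖ₑ ∂π := by
          rw [lintegral_add_left hgm, lintegral_const_mul' _ _ ENNReal.coe_ne_top,
            lintegral_const_mul' _ _ ENNReal.coe_ne_top]
      _ ≤ a * ∫⁻ γ, (∫⁻ t : I, ENNReal.ofReal (G (γ t)) * metricSpeed γ t) ∂π +
          b * ∫⁻ γ, (∫⁻ t : I, ENNReal.ofReal (H (γ t)) * metricSpeed γ t) ∂π := by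
          exact add_le_add (mul_le_mul_right (hg.le π hπ) _) (mul_le_mul_right (hh.le π hπ) _)
      _ = ∫⁻ γ, (∫⁻ t : I, a * (ENNReal.ofReal (G (γ t)) * metricSpeed γ t)) ∂π +
          ∫⁻ γ, (∫⁻ t : I, b * (ENNReal.ofReal (H (γ t)) * metricSpeed γ t)) ∂π := by
          simp_rw [lintegral_const_mul' _ _ ENNReal.coe_ne_top]
      _ ≤ ∫⁻ γ, ((∫⁻ t : I, a * (ENNReal.ofReal (G (γ t)) * metricSpeed γ t)) +
          ∫⁻ t : I, b * (ENNReal.ofReal (H (γ t)) * metricSpeed γ t)) ∂π := le_lintegral_add _ _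
      _ ≤ ∫⁻ γ, (∫⁻ t : I, (a * (ENNReal.ofReal (G (γ t)) * metricSpeed γ t) +
          b * (ENNReal.ofReal (H (γ t)) * metricSpeed γ t))) ∂π :=
          lintegral_mono fun γ => le_lintegral_add _ _
      _ = ∫⁻ γ, (∫⁻ t : I, ENNReal.ofReal (a * G (γ t) + b * H (γ t)) * metricSpeed γ t) ∂π := by
          refine lintegral_congr fun γ => lintegral_congr fun t => ?_
          have ha : 0 ≤ (a : ℝ) * G (γ t) := mul_nonneg a.2 (hg.nonneg _)
          have hb : 0 ≤ (b : ℝ) * H (γ t) := mul_nonneg b.2 (hh.nonneg _)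
          rw [ENNReal.ofReal_add ha hb, ENNReal.ofReal_mul a.coe_nonneg,
            ENNReal.ofReal_mul b.coe_nonneg, ENNReal.ofReal_coe_nnreal,
            ENNReal.ofReal_coe_nnreal, add_mul, mul_assoc, mul_assoc]

/-- The Sobolev class `S²(M)`: the functions in `L⁰(m)` that have a weak upper gradient in
`L²(m)`. -/
def SobolevClass {M : Type*} [MetricSpace M] [MeasurableSpace M] [BorelSpace M]
    (m : Measure M) : Submodule ℝ (M →ₘ[m] ℝ) where
  carrier := {f | ∃ G, IsWeakUpperGradient m f G}
  zero_mem' := by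
    refine ⟨fun _ => 0, measurable_const, fun _ => le_rfl, MemLp.zero, fun π hπ => ?_⟩
    have h : ∀ᵐ γ ∂π, ‖(0 : M →ₘ[m] ℝ) (γ 1) - (0 : M →ₘ[m] ℝ) (γ 0)‖ₑ = 0 := by
      filter_upwards [hπ.ae_comp 0 (AEEqFun.coeFn_zero (β := ℝ) (μ := m)),
        hπ.ae_comp 1 (AEEqFun.coeFn_zero (β := ℝ) (μ := m))] with γ h0 h1
      simp [h0, h1]
    rw [lintegral_congr_ae h]
    simp
  add_mem' := by
    rintro f g ⟨G, hG⟩ ⟨H, hH⟩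
    refine ⟨_, hG.of_increment_le hH 1 1 fun π hπ => ?_⟩
    filter_upwards [hπ.ae_comp 0 (AEEqFun.coeFn_add f g), hπ.ae_comp 1 (AEEqFun.coeFn_add f g)]
      with γ h0 h1
    rw [h0, h1]
    simp only [Pi.add_apply, ENNReal.coe_one, one_mul, add_sub_add_comm]
    exact enorm_add_le _ _
  smul_mem' := by
    rintro c f ⟨G, hG⟩
    refine ⟨_, hG.of_increment_le hG ‖c‖₊ 0 fun π hπ => ?_⟩
    filter_upwards [hπ.ae_comp 0 (AEEqFun.coeFn_smul c f), hπ.ae_comp 1 (AEEqFun.coeFn_smul c f)]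
      with γ h0 h1
    rw [h0, h1]
    simp only [Pi.smul_apply, ← smul_sub, enorm_smul, ENNReal.coe_zero, zero_mul, add_zero]
    exact le_rfl

/-- The product of two functions in `L^∞ ∩ S²(M)`, as an element of `S²(M)`. -/
def SobolevClass.mul {M : Type*} [MetricSpace M] [MeasurableSpace M] [BorelSpace M]
    {m : Measure M} (f g : SobolevClass m) (hf : (f : M →ₘ[m] ℝ) ∈ Lp ℝ ∞ m)
    (hg : (g : M →ₘ[m] ℝ) ∈ Lp ℝ ∞ m) : SobolevClass m :=
  ⟨f.1 * g.1, by
    obtain ⟨G, hG⟩ := f.2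
    obtain ⟨H, hH⟩ := g.2
    have bound : ∀ u : M →ₘ[m] ℝ, u ∈ Lp ℝ ∞ m → ∃ C : ℝ≥0, ∀ᵐ x ∂m, ‖u x‖ₑ ≤ C := by
      intro u hu
      have hu' : eLpNormEssSup u m < ∞ := by
        have := (Lp.mem_Lp_iff_memLp.1 hu).2
        rwa [eLpNorm_exponent_top] at this
      refine ⟨(eLpNormEssSup u m).toNNReal, ?_⟩
      rw [ENNReal.coe_toNNReal hu'.ne]
      exact ae_le_eLpNormEssSup
    obtain ⟨A, hA⟩ := bound _ hf
    obtain ⟨B, hB⟩ := bound _ hg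
    refine ⟨_, hG.of_increment_le hH B A fun π hπ => ?_⟩
    filter_upwards [hπ.ae_comp 0 (AEEqFun.coeFn_mul f.1 g.1),
      hπ.ae_comp 1 (AEEqFun.coeFn_mul f.1 g.1), hπ.ae_comp 1 hB, hπ.ae_comp 0 hA]
      with γ h0 h1 hB1 hA0
    rw [h0, h1]
    have e : (f.1 * g.1 : M → ℝ) (γ 1) - (f.1 * g.1 : M → ℝ) (γ 0) =
        g.1 (γ 1) * (f.1 (γ 1) - f.1 (γ 0)) + f.1 (γ 0) * (g.1 (γ 1) - g.1 (γ 0)) := by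
      simp only [Pi.mul_apply]; ring
    rw [e]
    refine (enorm_add_le _ _).trans ?_
    rw [enorm_mul, enorm_mul]
    gcongr⟩

theorem aestronglyMeasurable_comp_of_lipschitzOnWith {M : Type*} [MeasurableSpace M]
    {m : Measure M} (f : M →ₘ[m] ℝ) {U : Set ℝ} (hfU : m (f ⁻¹' Uᶜ) = 0) {φ : ℝ → ℝ} {K : ℝ≥0}
    (hφ : LipschitzOnWith K φ U) : AEStronglyMeasurable (fun x => φ (f x)) m := by
  obtain ⟨ψ, hψ, hψU⟩ := hφ.extend_real
  refine (hψ.continuous.comp_aestronglyMeasurable f.aestronglyMeasurable).congr ?_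
  have hU : ∀ᵐ x ∂m, f x ∈ U := by
    rw [ae_iff]
    exact hfU
  filter_upwards [hU] with x hx
  exact (hψU hx).symm

/-- The composition `φ ∘ f ∈ S²(M)`, where `f ∈ S²(M)` takes values in `U` almost everywhere and
`φ` is Lipschitz on `U`. The values of `φ` outside `U` are irrelevant. -/
def SobolevClass.comp {M : Type*} [MetricSpace M] [MeasurableSpace M] [BorelSpace M]
    {m : Measure M} (f : SobolevClass m) {U : Set ℝ} (hfU : m (f.1 ⁻¹' Uᶜ) = 0)
    {φ : ℝ → ℝ} {K : ℝ≥0} (hφ : LipschitzOnWith K φ U) : SobolevClass m :=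
  ⟨AEEqFun.mk (fun x => φ (f.1 x)) (aestronglyMeasurable_comp_of_lipschitzOnWith f.1 hfU hφ), by
    obtain ⟨G, hG⟩ := f.2
    have hU : ∀ᵐ x ∂m, f.1 x ∈ U := by
      rw [ae_iff]
      exact hfU
    have hc := AEEqFun.coeFn_mk (fun x => φ (f.1 x))
      (aestronglyMeasurable_comp_of_lipschitzOnWith f.1 hfU hφ)
    refine ⟨_, hG.of_increment_le hG K 0 fun π hπ => ?_⟩
    filter_upwards [hπ.ae_comp 0 hc, hπ.ae_comp 1 hc, hπ.ae_comp 0 hU, hπ.ae_comp 1 hU]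
      with γ h0 h1 hU0 hU1
    rw [h0, h1, ENNReal.coe_zero, zero_mul, add_zero, ← edist_eq_enorm_sub, ← edist_eq_enorm_sub]
    exact hφ hU1 hU0⟩

/-! ### Modules over `L^∞(m)` -/

namespace LInfty

/-- The product of two functions in `L^∞(m)`. -/
def mul {M : Type*} [MeasurableSpace M] {m : Measure M} (f g : Lp ℝ ∞ m) : Lp ℝ ∞ m :=
  ⟨f.1 * g.1, Lp.mem_Lp_iff_memLp.2
    (((Lp.memLp g).mul (Lp.memLp f)).ae_eq (AEEqFun.coeFn_mul f.1 g.1).symm)⟩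

/-- The characteristic function of a measurable set, in `L^∞(m)`. -/
def chi {M : Type*} [MeasurableSpace M] (m : Measure M) {A : Set M} (hA : MeasurableSet A) :
    Lp ℝ ∞ m :=
  MemLp.toLp (A.indicator fun _ => (1 : ℝ)) ((memLp_top_const 1).indicator hA)

end LInfty

/-- The structure of an `L^∞(m)`-module on a Banach space `V`: a bilinear multiplication
`L^∞(m) × V → V` which is associative, unital and contractive, and has the locality and gluing
properties. -/
structure LInftyModule {M : Type*} [MeasurableSpace M] (m : Measure M) (V : Type*)
    [NormedAddCommGroup V] [NormedSpace ℝ V] [CompleteSpace V] where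
  smul : Lp ℝ ∞ m →ₗ[ℝ] V →ₗ[ℝ] V
  mul_smul : ∀ (f g : Lp ℝ ∞ m) (v : V), smul (LInfty.mul f g) v = smul f (smul g v)
  one_smul : ∀ v : V, smul (LInfty.chi m MeasurableSet.univ) v = v
  norm_smul_le : ∀ (f : Lp ℝ ∞ m) (v : V), ‖smul f v‖ ≤ ‖f‖ * ‖v‖
  locality : ∀ (v : V) (A : ℕ → Set M) (hA : ∀ n, MeasurableSet (A n)),
    (∀ n, smul (LInfty.chi m (hA n)) v = 0) →
      smul (LInfty.chi m (MeasurableSet.iUnion hA)) v = 0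
  gluing : ∀ (v : ℕ → V) (A : ℕ → Set M) (hA : ∀ n, MeasurableSet (A n)),
    (∀ i j, smul (LInfty.chi m ((hA i).inter (hA j))) (v i) =
      smul (LInfty.chi m ((hA i).inter (hA j))) (v j)) →
    limsup (fun n => ‖∑ i ∈ Finset.range n, smul (LInfty.chi m (hA i)) (v i)‖ₑ) atTop < ∞ →
    ∃ w : V, (∀ i, smul (LInfty.chi m (hA i)) w = smul (LInfty.chi m (hA i)) (v i)) ∧
      ‖w‖ₑ ≤ liminf (fun n => ‖∑ i ∈ Finset.range n, smul (LInfty.chi m (hA i)) (v i)‖ₑ) atTop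

namespace LInftyModule

/-- `v = w` `m`-a.e. on `A`, i.e. `χ_A (v - w) = 0`. -/
def EqOn {M : Type*} [MeasurableSpace M] {m : Measure M} {V : Type*}
    [NormedAddCommGroup V] [NormedSpace ℝ V] [CompleteSpace V] (𝒜 : LInftyModule m V)
    {A : Set M} (hA : MeasurableSet A) (v w : V) : Prop :=
  𝒜.smul (LInfty.chi m hA) (v - w) = 0

/-- `L(fg) = f L(g) + g L(f)` for all `f, g ∈ L^∞ ∩ S²(M)`. -/
def LeibnizRule {M : Type*} [MetricSpace M] [MeasurableSpace M] [BorelSpace M] {m : Measure M}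
    {V : Type*} [NormedAddCommGroup V] [NormedSpace ℝ V] [CompleteSpace V]
    (𝒜 : LInftyModule m V) (L : SobolevClass m →ₗ[ℝ] V) : Prop :=
  ∀ (f g : SobolevClass m) (hf : (f : M →ₘ[m] ℝ) ∈ Lp ℝ ∞ m) (hg : (g : M →ₘ[m] ℝ) ∈ Lp ℝ ∞ m),
    L (SobolevClass.mul f g hf hg) = 𝒜.smul ⟨f, hf⟩ (L g) + 𝒜.smul ⟨g, hg⟩ (L f)

/-- For all `f ∈ S²(M)`: `L(f) = 0` a.e. on `f⁻¹(N)` for Lebesgue-null Borel sets `N ⊆ ℝ`, and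
`L(φ ∘ f) = (φ' ∘ f) L(f)` whenever `f ∈ U` a.e., `U` is open and `φ` is Lipschitz on `U`. Here
`φ' ∘ f` is any `ψ ∈ L^∞(m)` with `ψ(x) = φ'(f(x))` for a.e. `x` such that `φ` is differentiable at
`f(x)`; its values at the other points are arbitrary. -/
def ChainRule {M : Type*} [MetricSpace M] [MeasurableSpace M] [BorelSpace M] {m : Measure M}
    {V : Type*} [NormedAddCommGroup V] [NormedSpace ℝ V] [CompleteSpace V]
    (𝒜 : LInftyModule m V) (L : SobolevClass m →ₗ[ℝ] V) : Prop :=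
  ∀ f : SobolevClass m,
    (∀ (N : Set ℝ) (hN : MeasurableSet N), volume N = 0 →
      𝒜.EqOn (f.1.measurable hN) (L f) 0) ∧
    (∀ (U : Set ℝ) (φ : ℝ → ℝ) (K : ℝ≥0) (_ : IsOpen U) (hfU : m (f.1 ⁻¹' Uᶜ) = 0)
      (hφ : LipschitzOnWith K φ U) (ψ : Lp ℝ ∞ m),
      (∀ᵐ x ∂m, DifferentiableAt ℝ φ (f.1 x) → ψ x = deriv φ (f.1 x)) →
        L (SobolevClass.comp f hfU hφ) = 𝒜.smul ψ (L f))

/-- `L(f) = L(g)` a.e. on `{f = g}`, for all `f, g ∈ S²(M)`. -/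
def LocalityRule {M : Type*} [MetricSpace M] [MeasurableSpace M] [BorelSpace M] {m : Measure M}
    {V : Type*} [NormedAddCommGroup V] [NormedSpace ℝ V] [CompleteSpace V]
    (𝒜 : LInftyModule m V) (L : SobolevClass m →ₗ[ℝ] V) : Prop :=
  ∀ f g : SobolevClass m,
    𝒜.EqOn (measurableSet_eq_fun f.1.measurable g.1.measurable) (L f) (L g)

end LInftyModule

/-- The class of functions `φ' ∘ f` in the chain rule is never empty. -/
theorem exists_deriv_comp {M : Type*} [MeasurableSpace M] {m : Measure M} (f : M →ₘ[m] ℝ)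
    {U : Set ℝ} (hU : IsOpen U) (hfU : m (f ⁻¹' Uᶜ) = 0) {φ : ℝ → ℝ} {K : ℝ≥0}
    (hφ : LipschitzOnWith K φ U) :
    ∃ ψ : Lp ℝ ∞ m, ∀ᵐ x ∂m, DifferentiableAt ℝ φ (f x) → ψ x = deriv φ (f x) := by
  obtain ⟨g, hg, hgU⟩ := hφ.extend_real
  have hmem : MemLp (fun x => deriv g (f x)) ∞ m :=
    memLp_top_of_bound ((measurable_deriv g).comp f.measurable).aestronglyMeasurable K
      (ae_of_all _ fun x => norm_deriv_le_of_lipschitz hg)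
  refine ⟨hmem.toLp _, ?_⟩
  have hU' : ∀ᵐ x ∂m, f x ∈ U := by
    rw [ae_iff]
    exact hfU
  filter_upwards [hU', hmem.coeFn_toLp] with x hx hx' _
  rw [hx']
  exact (Filter.EventuallyEq.deriv_eq (hgU.eventuallyEq_of_mem (hU.mem_nhds hx))).symm

end

/-! ### Curves -/

/-! The map `L` sees compositions with `f` only through the finite measure `ν = f_*(G² m)` on the
line, where `G` is any weak upper gradient of `f`: if `φ` is a primitive of a bounded `ρ`, then
`‖L(φ ∘ f)‖² ≤ C² ∫ |ρ|² dν` (`SobolevClass.HasDensity.enorm_sq_le`). This holds because `|ρ ∘ f| G`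
is a weak upper gradient of `φ ∘ f` (`IsWeakUpperGradient.comp`), even though `f ∘ γ` need not be
continuous. Testing with conditioned and restricted plans bounds the increments of `f ∘ γ`, for
almost every curve, by the measure `G(γ_t) |γ̇_t| dt`. The image of that measure under `f ∘ γ`
therefore dominates Lebesgue measure between `f(γ₀)` and `f(γ₁)`. Taking `ρ = χ_{Nᶜ}` shows that `G`
may be chosen to vanish on `f⁻¹(N)` when `N` is null.

Locality gives the chain rule. If `ρ = 0` on an open set `U`, then `φ` is locally constant there,
and locality against countably many constants gives `L(φ ∘ f) = 0` on `f⁻¹(U)`. The estimate and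
outer regularity replace `U` by a Borel set; then `ρ` may be an indicator, a simple function, and
any bounded Borel function as a uniform limit.

The Leibniz rule gives locality. A truncation `u` of `h` that is constant near `h = 0` and near
infinity satisfies `u = u ξ` with a cutoff `ξ`, and both factors vanish on `{h = 0}`; hence `L u =
0` there. The estimate, with `ν {0} = 0`, lets the truncation tend to `h`.

The chain rule applied to `t ↦ t²` gives the Leibniz rule by polarization. -/

theorem measurable_metricSpeed {M : Type*} [MetricSpace M] [SecondCountableTopology M] :
    Measurable fun p : C(I, M) × I => metricSpeed p.1 p.2 := by
  obtain ⟨D, hDc, hD⟩ := TopologicalSpace.exists_countable_dense I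
  have key : ∀ p : C(I, M) × I, metricSpeed p.1 p.2 =
      ⨅ n : ℕ, ⨆ q ∈ D, if 0 < dist q p.2 ∧ dist q p.2 < 1 / ((n : ℝ) + 1) then
        edist (p.1 q) (p.1 p.2) / edist q p.2 else 0 := by
    rintro ⟨γ, t⟩
    have hb : (𝓝[≠] t).HasBasis (fun _ : ℕ => True)
        fun n => Metric.ball t (1 / ((n : ℝ) + 1)) ∩ {t}ᶜ :=
      nhdsWithin_hasBasis Metric.nhds_basis_ball_inv_nat_succ _
    simp only [metricSpeed]
    rw [hb.limsup_eq_iInf_iSup]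
    simp only [iInf_true]
    congr 1
    ext n
    apply le_antisymm
    -- For fixed `t` the difference quotient is continuous in `s ≠ t`, so its supremum over a
    -- punctured ball is attained along the countable dense set.
    · refine iSup₂_le fun s hs => le_of_forall_lt fun c hc => ?_
      have hst : s ≠ t := hs.2
      have hcont : ContinuousAt (fun s : I => edist (γ s) (γ t) / edist s t) s := by
        refine ENNReal.Tendsto.div ?_ (Or.inr ?_) ?_ (Or.inl ?_)
        · exact (Continuous.edist γ.continuous continuous_const).continuousAt
        · simpa using hst
        · exact (Continuous.edist continuous_id continuous_const).continuousAt
        · exact edist_ne_top _ _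
      have ho : ∀ᶠ q in 𝓝 s, c < edist (γ q) (γ t) / edist q t :=
        hcont.eventually (lt_mem_nhds hc)
      have ho2 : ∀ᶠ q in 𝓝 s, q ∈ Metric.ball t (1 / ((n : ℝ) + 1)) ∩ {t}ᶜ :=
        (Metric.isOpen_ball.inter isOpen_compl_singleton).mem_nhds hs
      obtain ⟨q, hq, hqD⟩ := mem_closure_iff_nhds.1 (hD s) _ (ho.and ho2)
      refine lt_of_lt_of_le hq.1 ?_
      refine le_iSup₂_of_le q hqD ?_
      rw [if_pos ⟨dist_pos.2 hq.2.2, hq.2.1⟩]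
    · refine iSup₂_le fun q _ => ?_
      split_ifs with h
      · exact le_iSup₂_of_le (f := fun (s : I) (_ : s ∈ Metric.ball t (1 / ((n : ℝ) + 1)) ∩ {t}ᶜ) =>
          edist (γ s) (γ t) / edist s t) q ⟨h.2, dist_pos.1 h.1⟩ le_rfl
      · exact zero_le
  simp_rw [key]
  borelize M
  refine Measurable.iInf fun n => Measurable.biSup _ hDc fun q _ => ?_
  have hd : Measurable fun p : C(I, M) × I => dist q p.2 :=
    (continuous_const.dist continuous_snd).measurable
  refine Measurable.ite ?_ ?_ measurable_const
  · exact (measurableSet_lt measurable_const hd).inter (measurableSet_lt hd measurable_const)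
  · refine Measurable.div ?_ ?_
    · have h1 : Continuous fun p : C(I, M) × I => p.1 q :=
        (ContinuousEvalConst.continuous_eval_const q).comp continuous_fst
      have h2 : Continuous fun p : C(I, M) × I => p.1 p.2 := by fun_prop
      exact (h1.edist h2).measurable
    · exact (continuous_const.edist continuous_snd).measurable

/-- A finite measure without atoms on the unit interval is transported to the Lebesgue measure by
its distribution function. -/
theorem map_measureReal_Iic (μ : Measure I) [IsFiniteMeasure μ] [NullSingletonClass μ] :
    Continuous (fun t => μ.real (Iic t)) ∧
    μ.map (fun t => μ.real (Iic t)) = volume.restrict (Icc 0 (μ.real univ)) := by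
  set H : I → ℝ := fun t => μ.real (Iic t) with hH
  have hcont : Continuous H := by
    have hH' : H = fun t => ∫ x, (Iic t).indicator (fun _ => (1 : ℝ)) x ∂μ := by
      ext t
      rw [integral_indicator_const _ measurableSet_Iic]
      simp [H]
    rw [hH']
    refine continuous_iff_continuousAt.2 fun t =>
      continuousAt_of_dominated (bound := fun _ => 1) ?_ ?_ (integrable_const _) ?_
    · exact Eventually.of_forall fun s =>
        (measurable_const.indicator measurableSet_Iic).aestronglyMeasurable
    · refine Eventually.of_forall fun s => ae_of_all _ fun x => ?_
      by_cases hx : x ∈ Iic s <;> simp [hx]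
    · have : ∀ᵐ x ∂μ, x ≠ t := by
        rw [ae_iff]
        simp
      filter_upwards [this] with x hx
      rcases lt_or_gt_of_ne hx with h | h
      · refine continuousAt_const.congr (f := fun _ => (1 : ℝ)) ?_
        filter_upwards [lt_mem_nhds h] with s hs
        simp [hs.le]
      · refine continuousAt_const.congr (f := fun _ => (0 : ℝ)) ?_
        filter_upwards [gt_mem_nhds h] with s hs
        simp [hs]
  refine ⟨hcont, ?_⟩
  have hmono : Monotone H := fun s t hst => measureReal_mono (Iic_subset_Iic.2 hst)
  have h0 : H 0 = 0 := by
    have : Iic (0 : I) = {0} := by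
      ext x; simp
    simp [H, this, Measure.real]
  have h1 : H 1 = μ.real univ := by
    have : Iic (1 : I) = univ := by
      ext x; simp [unitInterval.le_one']
    simp [H, this]
  refine Measure.ext_of_Iic _ _ fun a => ?_
  rw [Measure.map_apply hcont.measurable measurableSet_Iic, Measure.restrict_apply measurableSet_Iic]
  rcases lt_or_ge a 0 with ha | ha
  · have e1 : H ⁻¹' Iic a = ∅ := by
      ext t
      simpa using ha.trans_le measureReal_nonneg
    have e2 : Iic a ∩ Icc 0 (μ.real univ) = ∅ := by
      ext t
      simp only [mem_inter_iff, mem_Iic, mem_Icc, mem_empty_iff_false, iff_false]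
      rintro ⟨h, h', -⟩
      linarith
    simp [e1, e2]
  have e2 : Iic a ∩ Icc 0 (μ.real univ) = Icc 0 (min a (μ.real univ)) := by
    ext t
    simp only [mem_inter_iff, mem_Iic, mem_Icc, le_min_iff]
    tauto
  rw [e2, Real.volume_Icc, sub_zero]
  set b := min a (μ.real univ) with hb
  have hb0 : 0 ≤ b := le_min ha measureReal_nonneg
  have e1 : H ⁻¹' Iic a = H ⁻¹' Iic b := by
    ext t
    have : H t ≤ μ.real univ := measureReal_mono (subset_univ _)
    simp [hb, this]
  rw [e1]
  obtain ⟨τ, hτ⟩ : b ∈ range H := by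
    refine mem_range_of_exists_le_of_exists_ge hcont ⟨0, ?_⟩ ⟨1, ?_⟩
    · rwa [h0]
    · rw [h1]; exact min_le_right _ _
  -- The sublevel set is an initial segment `Iic τ'`, and `H τ' = b` because the value `b` is
  -- attained; its mass is therefore `b`.
  have hcl : IsCompact (H ⁻¹' Iic b) := (isClosed_Iic.preimage hcont).isCompact
  obtain ⟨τ', hτ', hmax⟩ := hcl.exists_isGreatest ⟨τ, by simp [hτ]⟩
  have e3 : H ⁻¹' Iic b = Iic τ' := by
    ext t
    exact ⟨fun h => hmax h, fun h => (hmono h).trans hτ'⟩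
  have e4 : H τ' = b := le_antisymm hτ' (hτ ▸ hmono (hmax (by simp [hτ])))
  rw [e3, ← e4, ofReal_measureReal]

/-- Every point between `w a` and `w b` has a preimage between `a` and `b`, and a 1-Lipschitz map
does not increase Lebesgue measure, which is one-dimensional Hausdorff measure. -/
theorem LipschitzWith.restrict_uIcc_le_map {w : ℝ → ℝ} (hw : LipschitzWith 1 w) (a b : ℝ) :
    volume.restrict (uIcc (w a) (w b)) ≤ (volume.restrict (uIcc a b)).map w := by
  refine Measure.le_iff.2 fun B hB => ?_
  rw [Measure.restrict_apply hB, Measure.map_apply hw.continuous.measurable hB,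
    Measure.restrict_apply (hw.continuous.measurable hB)]
  calc volume (B ∩ uIcc (w a) (w b)) ≤ volume (w '' (w ⁻¹' B ∩ uIcc a b)) := by
        refine measure_mono ?_
        rintro y ⟨hyB, hy⟩
        obtain ⟨x, hx, rfl⟩ := intermediate_value_uIcc hw.continuous.continuousOn hy
        exact ⟨x, ⟨hyB, hx⟩, rfl⟩
    _ ≤ volume (w ⁻¹' B ∩ uIcc a b) := by
        have := (hw.lipschitzOnWith (s := w ⁻¹' B ∩ uIcc a b)).hausdorffMeasure_image_le
          zero_le_one
        rwa [hausdorffMeasure_real, ENNReal.coe_one, ENNReal.one_rpow, one_mul] at this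

/-- If the increments of `u` are controlled by the `μ`-measure of the intervals, then `μ` is
transported by `u` to a measure dominating the Lebesgue measure between the endpoint values. -/
theorem restrict_uIcc_le_map_of_increments (μ : Measure I) [IsFiniteMeasure μ]
    [NullSingletonClass μ] {u : I → ℝ} {D E : Set I} (hD : Dense D)
    (h0 : 0 ∈ E) (h1 : 1 ∈ E) (hE : ∀ᵐ t ∂μ, t ∈ E)
    (h : ∀ t ∈ E, ∀ q ∈ D, dist (u t) (u q) ≤ |μ.real (Iic t) - μ.real (Iic q)|) :
    volume.restrict (uIcc (u 0) (u 1)) ≤ μ.map u := by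
  obtain ⟨hcont, hmap⟩ := map_measureReal_Iic μ
  set H : I → ℝ := fun t => μ.real (Iic t) with hH
  have hmono : Monotone H := fun s t hst => measureReal_mono (Iic_subset_Iic.2 hst)
  -- The hypothesis compares points of `E` only with points of `D`. An intermediate `q ∈ D` loses
  -- nothing, since the increments of the monotone `H` add up.
  have hlt : ∀ s ∈ E, ∀ t ∈ E, s < t → dist (u s) (u t) ≤ dist (H s) (H t) := by
    intro s hs t ht hst
    obtain ⟨q, hq, hsq, hqt⟩ := hD.exists_between hst
    have a1 := h s hs q hq
    have a2 := h t ht q hq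
    have b1 := hmono hsq.le
    have b2 := hmono hqt.le
    rw [abs_of_nonpos (sub_nonpos.2 b1)] at a1
    rw [abs_of_nonneg (sub_nonneg.2 b2)] at a2
    rw [Real.dist_eq (H s), abs_of_nonpos (sub_nonpos.2 (b1.trans b2))]
    have := dist_triangle_right (u s) (u t) (u q)
    linarith
  have hle : ∀ s ∈ E, ∀ t ∈ E, dist (u s) (u t) ≤ dist (H s) (H t) := by
    intro s hs t ht
    rcases lt_trichotomy s t with hst | rfl | hst
    · exact hlt s hs t ht hst
    · simp
    · rw [dist_comm, dist_comm (H s)]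
      exact hlt t ht s hs hst
  -- On `E`, `u` factors through `H` as a 1-Lipschitz function, extended to `w` on the line. As `H`
  -- carries `μ` to Lebesgue measure, the claim reduces to the one for `w`.
  have hlip : LipschitzOnWith 1 (fun y => u (Function.invFunOn H E y)) (H '' E) := by
    refine LipschitzOnWith.of_dist_le_mul fun x hx y hy => ?_
    have := hle _ (Function.invFunOn_mem hx) _ (Function.invFunOn_mem hy)
    rwa [Function.invFunOn_eq hx, Function.invFunOn_eq hy, ← one_mul (dist x y)] at this
  obtain ⟨w, hw, hwE⟩ := hlip.extend_real
  have huw : ∀ t ∈ E, u t = w (H t) := by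
    intro t ht
    have hx : H t ∈ H '' E := mem_image_of_mem H ht
    rw [← hwE hx]
    have := hle t ht _ (Function.invFunOn_mem hx)
    rw [Function.invFunOn_eq hx, dist_self] at this
    exact dist_le_zero.1 this
  have hH0 : H 0 = 0 := by
    have : Iic (0 : I) = {0} := by
      ext x; simp
    simp [H, this, Measure.real]
  have hH1 : H 1 = μ.real univ := by
    have : Iic (1 : I) = univ := by
      ext x; simp [unitInterval.le_one']
    simp [H, this]
  have hae : u =ᵐ[μ] w ∘ H := by
    filter_upwards [hE] with t ht using huw t ht
  rw [Measure.map_congr hae, ← Measure.map_map hw.continuous.measurable hcont.measurable, hmap,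
    huw 0 h0, huw 1 h1, ← uIcc_of_le measureReal_nonneg, hH0, hH1]
  exact hw.restrict_uIcc_le_map _ _

/-! ### Restriction of curves and test plans to subintervals -/

/-- The affine parametrization of the segment from `s` to `t`. -/
def unitInterval.segment (s t : I) : C(I, I) where
  toFun r := ⟨s + (t - s) * r, by
    have := convex_Icc (0 : ℝ) 1 s.2 t.2 (sub_nonneg.2 r.2.2) r.2.1 (sub_add_cancel _ _)
    convert this using 1
    simp only [smul_eq_mul]
    ring⟩

theorem unitInterval.coe_segment (s t r : I) :
    (unitInterval.segment s t r : ℝ) = s + (t - s) * r := rfl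

theorem unitInterval.segment_zero (s t : I) : unitInterval.segment s t 0 = s := by
  ext; simp [unitInterval.coe_segment]

theorem unitInterval.segment_one (s t : I) : unitInterval.segment s t 1 = t := by
  ext; simp [unitInterval.coe_segment]

theorem unitInterval.lintegral_segment {s t : I} (hst : s < t) (g : I → ℝ≥0∞) :
    ENNReal.ofReal (t - s) * ∫⁻ r, g (unitInterval.segment s t r) = ∫⁻ r in Icc s t, g r := by
  have hst' : (s : ℝ) < t := hst
  set g' : ℝ → ℝ≥0∞ := fun x => g (projIcc 0 1 zero_le_one x) with hg'
  have e : ∀ F : ℝ → ℝ≥0∞, ∫⁻ r : I, F r = ∫⁻ x in Icc 0 1, F x := fun F =>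
    lintegral_subtype_comap measurableSet_Icc F
  have e1 : ∫⁻ r in Icc s t, g r = ∫⁻ x in Icc (s : ℝ) t, g' x := by
    have hsub : Icc (s : ℝ) t ⊆ Icc 0 1 := Icc_subset_Icc s.2.1 t.2.2
    rw [← lintegral_indicator measurableSet_Icc]
    have := e ((Icc (s : ℝ) t).indicator g')
    rw [lintegral_indicator measurableSet_Icc, Measure.restrict_restrict measurableSet_Icc,
      inter_eq_left.2 hsub] at this
    rw [← this]
    refine lintegral_congr fun r => ?_
    by_cases hr : r ∈ Icc s t
    · have hr' : (r : ℝ) ∈ Icc (s : ℝ) t := hr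
      rw [indicator_of_mem hr, indicator_of_mem hr', hg']
      simp
    · have hr' : (r : ℝ) ∉ Icc (s : ℝ) t := hr
      rw [indicator_of_notMem hr, indicator_of_notMem hr']
  have e2 : ∫⁻ r, g (unitInterval.segment s t r) =
      ∫⁻ x in Icc (0 : ℝ) 1, g' (s + (t - s) * x) := by
    rw [← e]
    refine lintegral_congr fun r => ?_
    rw [hg', ← unitInterval.coe_segment]
    simp
  have him : (fun x : ℝ => s + (t - s) * x) '' Icc 0 1 = Icc (s : ℝ) t := by
    ext y
    constructor
    · rintro ⟨x, hx, rfl⟩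
      constructor
      · nlinarith [hx.1]
      · nlinarith [hx.2]
    · intro hy
      refine ⟨(y - s) / (t - s), ⟨div_nonneg (sub_nonneg.2 hy.1) (sub_nonneg.2 hst'.le), ?_⟩, ?_⟩
      · rw [div_le_one (sub_pos.2 hst')]
        linarith [hy.2]
      · have : (t : ℝ) - s ≠ 0 := (sub_pos.2 hst').ne'
        simp only
        field_simp
        ring
  rw [e1, e2, ← him, lintegral_image_eq_lintegral_abs_deriv_mul (f' := fun _ => (t : ℝ) - s)
    measurableSet_Icc, abs_of_pos (sub_pos.2 hst'), lintegral_const_mul' _ _ ENNReal.ofReal_ne_top]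
  · intro x _
    simpa using (((hasDerivAt_id x).const_mul ((t : ℝ) - s)).const_add (s : ℝ)).hasDerivWithinAt
  · intro x _ y _ hxy
    have h := add_left_cancel hxy
    exact mul_left_cancel₀ (sub_pos.2 hst').ne' h

theorem IsACCurve.comp_segment {M : Type*} [MetricSpace M] {γ : C(I, M)} (hγ : IsACCurve γ)
    {s t : I} (hst : s < t) : IsACCurve (γ.comp (unitInterval.segment s t)) := by
  obtain ⟨f, hf, hd⟩ := hγ
  have hst' : (s : ℝ) < t := hst
  have hc : (t : ℝ) - s ≠ 0 := (sub_pos.2 hst').ne'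
  refine ⟨fun r => (t - s) * f (s + (t - s) * r), ?_, fun a b hab => ?_⟩
  · have h1 : IntervalIntegrable f volume s t := by
      refine hf.mono_set ?_
      rw [uIcc_of_le hst'.le, uIcc_of_le zero_le_one]
      exact Icc_subset_Icc s.2.1 t.2.2
    have h2 := (h1.comp_add_left (s : ℝ)).comp_mul_left (c := (t : ℝ) - s)
    rw [sub_self, zero_div, div_self hc] at h2
    exact h2.const_mul _
  · have hab' : (a : ℝ) < b := hab
    rw [intervalIntegral.integral_const_mul, intervalIntegral.mul_integral_comp_add_mul]
    exact hd _ _ (show (s : ℝ) + (t - s) * a < s + (t - s) * b by nlinarith [sub_pos.2 hst'])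

/-- Equality can fail at the endpoints of the segment, which are approached from one side only; the
upper limit is then over a smaller filter. -/
theorem metricSpeed_comp_segment_le {M : Type*} [MetricSpace M] (γ : C(I, M)) {s t : I}
    (hst : s < t) (r : I) : metricSpeed (γ.comp (unitInterval.segment s t)) r ≤
      ENNReal.ofReal (t - s) * metricSpeed γ (unitInterval.segment s t r) := by
  have hst' : (s : ℝ) < t := hst
  have hpos : 0 < (t : ℝ) - s := sub_pos.2 hst'
  have hinj : Function.Injective (unitInterval.segment s t) := by
    intro x y hxy
    have := congrArg (fun z : I => (z : ℝ)) hxy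
    simp only [unitInterval.coe_segment] at this
    exact Subtype.ext (mul_left_cancel₀ hpos.ne' (add_left_cancel this))
  have hedist : ∀ q, edist (unitInterval.segment s t q) (unitInterval.segment s t r) =
      ENNReal.ofReal (t - s) * edist q r := by
    intro q
    rw [edist_dist, edist_dist, ← ENNReal.ofReal_mul hpos.le]
    congr 1
    rw [Subtype.dist_eq, Subtype.dist_eq, Real.dist_eq, Real.dist_eq, unitInterval.coe_segment,
      unitInterval.coe_segment, ← abs_of_pos hpos, ← abs_mul, abs_of_pos hpos]
    congr 1
    ring
  have h0 : ENNReal.ofReal ((t : ℝ) - s) ≠ 0 := by simpa using hst'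
  have hT : ENNReal.ofReal ((t : ℝ) - s) ≠ ∞ := ENNReal.ofReal_ne_top
  have hlim : Tendsto (unitInterval.segment s t) (𝓝[≠] r) (𝓝[≠] (unitInterval.segment s t r)) :=
    (map_continuous (unitInterval.segment s t)).continuousWithinAt.tendsto_nhdsWithin
      fun x hx => hinj.ne hx
  unfold metricSpeed
  rw [← ENNReal.limsup_const_mul_of_ne_top hT]
  refine le_trans (le_of_eq ?_) (limsup_le_limsup_of_le hlim)
  rw [← Function.id_comp (unitInterval.segment s t : I → I), ← limsup_comp]
  congr 1
  ext q
  simp only [Function.comp_apply, id, ContinuousMap.comp_apply]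
  rw [hedist, div_eq_mul_inv, div_eq_mul_inv, ENNReal.mul_inv (Or.inl h0) (Or.inl hT),
    mul_left_comm, ← mul_assoc (ENNReal.ofReal _), ENNReal.mul_inv_cancel h0 hT, one_mul]

/-- The squared speed gains a factor `(t - s)²`; one power is absorbed by the change of variables
and the other is at most 1. -/
theorem curveEnergy_comp_segment_le {M : Type*} [MetricSpace M] (γ : C(I, M)) {s t : I}
    (hst : s < t) : curveEnergy (γ.comp (unitInterval.segment s t)) ≤ curveEnergy γ := by
  by_cases hγ : IsACCurve γ
  · rw [curveEnergy, curveEnergy, if_pos hγ, if_pos (hγ.comp_segment hst)]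
    have hle : ENNReal.ofReal ((t : ℝ) - s) ≤ 1 := by
      rw [ENNReal.ofReal_le_one]
      linarith [t.2.2, s.2.1]
    calc ∫⁻ r, metricSpeed (γ.comp (unitInterval.segment s t)) r ^ 2
        ≤ ∫⁻ r, ENNReal.ofReal (t - s) * metricSpeed γ (unitInterval.segment s t r) ^ 2 := by
          refine lintegral_mono fun r => ?_
          calc _ ≤ (ENNReal.ofReal (t - s) * metricSpeed γ (unitInterval.segment s t r)) ^ 2 := by
                gcongr
                exact metricSpeed_comp_segment_le γ hst r
            _ = ENNReal.ofReal (t - s) * (ENNReal.ofReal (t - s) *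
                  metricSpeed γ (unitInterval.segment s t r) ^ 2) := by ring
            _ ≤ _ := by
                gcongr
                exact mul_le_of_le_one_left' hle
      _ = ∫⁻ r in Icc s t, metricSpeed γ r ^ 2 := by
          rw [lintegral_const_mul' _ _ ENNReal.ofReal_ne_top,
            unitInterval.lintegral_segment hst fun r => metricSpeed γ r ^ 2]
      _ ≤ _ := setLIntegral_le_lintegral _ _
  · rw [curveEnergy, curveEnergy, if_neg hγ]
    exact le_top

theorem measurable_comp_segment {M : Type*} [TopologicalSpace M] (s t : I) :
    Measurable fun γ : C(I, M) => γ.comp (unitInterval.segment s t) :=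
  (ContinuousMap.continuous_precomp _).measurable

theorem measurable_eval_curve {M : Type*} [MetricSpace M] [MeasurableSpace M] [BorelSpace M]
    (t : I) : Measurable fun γ : C(I, M) => γ t :=
  (ContinuousEvalConst.continuous_eval_const t).measurable

/-- A test plan conditioned to a set of curves of positive mass and restricted to a subinterval is
a test plan. -/
theorem IsTestPlan.restrict_segment {M : Type*} [MetricSpace M] [MeasurableSpace M] [BorelSpace M]
    {m : Measure M} {π : Measure C(I, M)} (hπ : IsTestPlan m π) {Γ : Set C(I, M)}
    (hΓ : π Γ ≠ 0) {s t : I} (hst : s < t) :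
    IsTestPlan m (((π Γ)⁻¹ • π.restrict Γ).map fun γ => γ.comp (unitInterval.segment s t)) where
  isProbabilityMeasure := by
    have := hπ.isProbabilityMeasure
    have : IsProbabilityMeasure ((π Γ)⁻¹ • π.restrict Γ) :=
      ⟨by simp [ENNReal.inv_mul_cancel hΓ (measure_ne_top _ _)]⟩
    exact Measure.isProbabilityMeasure_map (measurable_comp_segment s t).aemeasurable
  boundedCompression := by
    obtain ⟨C, hC⟩ := hπ.boundedCompression
    refine ⟨(π Γ)⁻¹.toNNReal * C, fun r => ?_⟩
    rw [Measure.map_map (measurable_eval_curve r) (measurable_comp_segment s t)]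
    have hT : (π Γ)⁻¹ ≠ ∞ := ENNReal.inv_ne_top.2 hΓ
    refine Measure.le_iff.2 fun B hB => ?_
    have hm : Measurable ((fun γ : C(I, M) => γ r) ∘
        fun γ : C(I, M) => γ.comp (unitInterval.segment s t)) :=
      (measurable_eval_curve r).comp (measurable_comp_segment s t)
    rw [Measure.map_apply hm hB]
    calc ((π Γ)⁻¹ • π.restrict Γ) _
        ≤ (π Γ)⁻¹ * π ((fun γ : C(I, M) => γ (unitInterval.segment s t r)) ⁻¹' B) := by
          rw [Measure.smul_apply, smul_eq_mul]
          gcongr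
          · exact Measure.restrict_le_self
          · exact subset_rfl
      _ = (π Γ)⁻¹ * π.map (fun γ : C(I, M) => γ (unitInterval.segment s t r)) B := by
          rw [Measure.map_apply (measurable_eval_curve _) hB]
      _ ≤ (π Γ)⁻¹ * (C • m) B := by
          gcongr
          exact hC _
      _ = _ := by
          rw [Measure.coe_nnreal_smul_apply, Measure.coe_nnreal_smul_apply, ENNReal.coe_mul,
            ENNReal.coe_toNNReal hT, mul_assoc]
  finiteEnergy := by
    refine (lintegral_map_le _ _).trans_lt ?_
    rw [lintegral_smul_measure, smul_eq_mul]
    refine ENNReal.mul_lt_top (ENNReal.inv_lt_top.2 (pos_iff_ne_zero.2 hΓ)) ?_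
    refine (setLIntegral_le_lintegral _ _).trans_lt ?_
    exact (lintegral_mono fun γ => curveEnergy_comp_segment_le γ hst).trans_lt hπ.finiteEnergy

theorem measurable_eval_prod {M : Type*} [MetricSpace M] [SecondCountableTopology M]
    [MeasurableSpace M] [BorelSpace M] : Measurable fun p : C(I, M) × I => p.1 p.2 := by
  have : Continuous fun p : C(I, M) × I => p.1 p.2 := by fun_prop
  exact this.measurable

theorem measurable_mul_metricSpeed {M : Type*} [MetricSpace M] [SecondCountableTopology M]
    [MeasurableSpace M] [BorelSpace M] {G : M → ℝ} (hG : Measurable G) :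
    Measurable fun p : C(I, M) × I => ENNReal.ofReal (G (p.1 p.2)) * metricSpeed p.1 p.2 :=
  (hG.comp measurable_eval_prod).ennreal_ofReal.mul measurable_metricSpeed

/-! ### Weak upper gradients along almost every curve -/

theorem IsWeakUpperGradient.ae_increment_le {M : Type*} [MetricSpace M]
    [SecondCountableTopology M] [MeasurableSpace M] [BorelSpace M] {m : Measure M}
    {f : M →ₘ[m] ℝ} {G : M → ℝ} (hG : IsWeakUpperGradient m f G) {π : Measure C(I, M)}
    (hπ : IsTestPlan m π) {s t : I} (hst : s < t) :
    ∀ᵐ γ ∂π, ‖f (γ t) - f (γ s)‖ₑ ≤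
      ∫⁻ r in Icc s t, ENNReal.ofReal (G (γ r)) * metricSpeed γ r := by
  have := hπ.isProbabilityMeasure
  have hfm : ∀ s t : I, Measurable fun γ : C(I, M) => ‖f (γ t) - f (γ s)‖ₑ := fun s t =>
    ((f.measurable.comp (measurable_eval_curve t)).sub
      (f.measurable.comp (measurable_eval_curve s))).enorm
  have hgm := measurable_mul_metricSpeed hG.measurable
  -- The pointwise inequality follows from the integrated one over every set `Γ` of curves:
  -- conditioning the plan to `Γ` gives a test plan again, and the normalizing factor cancels.
  refine ae_le_of_forall_setLIntegral_le_of_sigmaFinite (hfm s t) fun Γ hΓ _ => ?_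
  by_cases h0 : π Γ = 0
  · simp [Measure.restrict_eq_zero.2 h0]
  have hT : (π Γ)⁻¹ ≠ ∞ := ENNReal.inv_ne_top.2 h0
  have hI : (π Γ)⁻¹ ≠ 0 := ENNReal.inv_ne_zero.2 (measure_ne_top _ _)
  have h := hG.le _ (hπ.restrict_segment h0 hst)
  rw [lintegral_map (hfm 0 1) (measurable_comp_segment s t),
    lintegral_map hgm.lintegral_prod_right' (measurable_comp_segment s t),
    lintegral_smul_measure, lintegral_smul_measure, smul_eq_mul, smul_eq_mul,
    ENNReal.mul_le_mul_iff_right hI hT] at h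
  simp only [ContinuousMap.comp_apply, unitInterval.segment_zero, unitInterval.segment_one] at h
  refine h.trans (lintegral_mono fun γ => ?_)
  rw [← unitInterval.lintegral_segment hst fun r => ENNReal.ofReal (G (γ r)) * metricSpeed γ r,
    ← lintegral_const_mul' _ _ ENNReal.ofReal_ne_top]
  refine lintegral_mono fun r => ?_
  rw [mul_left_comm]
  gcongr
  exact metricSpeed_comp_segment_le γ hst r

/-- Since `ab ≤ a² + b²`, the integral splits into the part of `G²`, controlled by bounded
compression, and the kinetic energy. -/
theorem IsTestPlan.ae_lintegral_speed_lt_top {M : Type*} [MetricSpace M]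
    [SecondCountableTopology M] [MeasurableSpace M] [BorelSpace M] {m : Measure M} {G : M → ℝ}
    (hGm : Measurable G) (hG : MemLp G 2 m) {π : Measure C(I, M)} (hπ : IsTestPlan m π) :
    ∀ᵐ γ ∂π, ∫⁻ t, ENNReal.ofReal (G (γ t)) * metricSpeed γ t < ∞ := by
  have := hπ.isProbabilityMeasure
  refine ae_lt_top (measurable_mul_metricSpeed hGm).lintegral_prod_right' (ne_of_lt ?_)
  have hG2 : Measurable fun x => ENNReal.ofReal (G x) ^ 2 := hGm.ennreal_ofReal.pow_const 2
  have hp : Measurable fun p : C(I, M) × I => ENNReal.ofReal (G (p.1 p.2)) ^ 2 :=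
    hG2.comp measurable_eval_prod
  obtain ⟨C, hC⟩ := hπ.boundedCompression
  have hfin : ∫⁻ x, ENNReal.ofReal (G x) ^ 2 ∂m < ∞ := by
    refine lt_of_le_of_lt (lintegral_mono fun x => ?_)
      (lintegral_rpow_enorm_lt_top_of_eLpNorm_lt_top two_ne_zero ENNReal.ofNat_ne_top hG.2)
    simp only [ENNReal.toReal_ofNat, ENNReal.rpow_ofNat]
    gcongr
    rw [Real.enorm_eq_ofReal_abs]
    exact ENNReal.ofReal_le_ofReal (le_abs_self _)
  calc ∫⁻ γ, (∫⁻ t, ENNReal.ofReal (G (γ t)) * metricSpeed γ t) ∂π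
      ≤ ∫⁻ γ, ((∫⁻ t, ENNReal.ofReal (G (γ t)) ^ 2) + ∫⁻ t, metricSpeed γ t ^ 2) ∂π := by
        refine lintegral_mono fun γ => ?_
        have hγ : Measurable fun t => ENNReal.ofReal (G (γ t)) ^ 2 :=
          hp.comp measurable_prodMk_left
        rw [← lintegral_add_left hγ]
        refine lintegral_mono fun t => ?_
        rcases le_total (ENNReal.ofReal (G (γ t))) (metricSpeed γ t) with h | h
        · exact le_add_left ((mul_le_mul_left h _).trans_eq (sq _).symm)
        · exact le_add_right ((mul_le_mul_right h _).trans_eq (sq _).symm)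
    _ = (∫⁻ t, ∫⁻ γ, ENNReal.ofReal (G (γ t)) ^ 2 ∂π) +
          ∫⁻ γ, (∫⁻ t, metricSpeed γ t ^ 2) ∂π := by
        rw [lintegral_add_left hp.lintegral_prod_right', lintegral_lintegral_swap hp.aemeasurable]
    _ ≤ (∫⁻ _ : I, C * ∫⁻ x, ENNReal.ofReal (G x) ^ 2 ∂m) + ∫⁻ γ, curveEnergy γ ∂π := by
        refine add_le_add (lintegral_mono fun t => ?_) (lintegral_mono fun γ => ?_)
        · calc _ = ∫⁻ x, ENNReal.ofReal (G x) ^ 2 ∂(π.map fun γ => γ t) :=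
                (lintegral_map hG2 (measurable_eval_curve t)).symm
            _ ≤ ∫⁻ x, ENNReal.ofReal (G x) ^ 2 ∂(C • m) := lintegral_mono' (hC t) le_rfl
            _ = _ := by rw [lintegral_smul_measure, ENNReal.smul_def, smul_eq_mul]
        · unfold curveEnergy
          split_ifs
          · exact le_rfl
          · exact le_top
    _ < ∞ := by
        refine ENNReal.add_lt_top.2 ⟨?_, hπ.finiteEnergy⟩
        rw [lintegral_const, measure_univ, mul_one]
        exact ENNReal.mul_lt_top ENNReal.coe_lt_top hfin

/-- Along almost every curve, the measure `G(γ_t) |γ̇_t| dt` is transported by `f ∘ γ` to a measure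
dominating the Lebesgue measure between `f(γ₀)` and `f(γ₁)`. -/
theorem IsWeakUpperGradient.ae_restrict_uIcc_le_map {M : Type*} [MetricSpace M]
    [SecondCountableTopology M] [MeasurableSpace M] [BorelSpace M] {m : Measure M}
    {f : M →ₘ[m] ℝ} {G : M → ℝ} (hG : IsWeakUpperGradient m f G) {π : Measure C(I, M)}
    (hπ : IsTestPlan m π) :
    ∀ᵐ γ ∂π, volume.restrict (uIcc (f (γ 0)) (f (γ 1))) ≤
      (volume.withDensity fun t => ENNReal.ofReal (G (γ t)) * metricSpeed γ t).map
        fun t => f (γ t) := by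
  have := hπ.isProbabilityMeasure
  obtain ⟨D₀, hD₀c, hD₀⟩ := TopologicalSpace.exists_countable_dense I
  -- The endpoints are added so that 0 and 1 belong to the good set `E` below: their values enter
  -- the conclusion and cannot be discarded as a null set of times.
  set D : Set I := D₀ ∪ {0, 1} with hDdef
  have hDc : D.Countable := hD₀c.union (by simp)
  have hD : Dense D := hD₀.mono subset_union_left
  have hm := measurable_mul_metricSpeed (M := M) hG.measurable
  have hpair : ∀ t q : I, ∀ᵐ γ ∂π, ‖f (γ t) - f (γ q)‖ₑ ≤
      ∫⁻ r in uIcc t q, ENNReal.ofReal (G (γ r)) * metricSpeed γ r := by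
    intro t q
    rcases lt_trichotomy t q with h | rfl | h
    · rw [uIcc_of_le h.le]
      filter_upwards [hG.ae_increment_le hπ h] with γ hγ
      rwa [← neg_sub, enorm_neg]
    · simp
    · rw [uIcc_of_ge h.le]
      exact hG.ae_increment_le hπ h
  have hall : ∀ t : I, ∀ᵐ γ ∂π, ∀ q ∈ D, ‖f (γ t) - f (γ q)‖ₑ ≤
      ∫⁻ r in uIcc t q, ENNReal.ofReal (G (γ r)) * metricSpeed γ r := fun t =>
    (ae_ball_iff hDc).2 fun q _ => hpair t q
  have hDall := (ae_ball_iff hDc).2 fun t _ => hall t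
  -- Fubini exchanges "each time, almost every curve" with "almost every curve, almost every time";
  -- this is where joint measurability is needed.
  have hcomm : ∀ᵐ γ ∂π, ∀ᵐ t : I, ∀ q ∈ D, ‖f (γ t) - f (γ q)‖ₑ ≤
      ∫⁻ r in uIcc t q, ENNReal.ofReal (G (γ r)) * metricSpeed γ r := by
    rw [Measure.ae_ae_comm]
    · exact ae_of_all _ hall
    · have : {x : C(I, M) × I | ∀ q ∈ D, ‖f (x.1 x.2) - f (x.1 q)‖ₑ ≤
          ∫⁻ r in uIcc x.2 q, ENNReal.ofReal (G (x.1 r)) * metricSpeed x.1 r} =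
          ⋂ q ∈ D, {x : C(I, M) × I | ‖f (x.1 x.2) - f (x.1 q)‖ₑ ≤
          ∫⁻ r in uIcc x.2 q, ENNReal.ofReal (G (x.1 r)) * metricSpeed x.1 r} := by
        ext x; simp
      rw [this]
      refine MeasurableSet.biInter hDc fun q _ => measurableSet_le ?_ ?_
      · exact ((f.measurable.comp measurable_eval_prod).sub
          (f.measurable.comp ((measurable_eval_curve q).comp measurable_fst))).enorm
      · have hset : MeasurableSet {y : (C(I, M) × I) × I | y.2 ∈ uIcc y.1.2 q} := by
          have : IsClosed {y : (C(I, M) × I) × I | y.2 ∈ uIcc y.1.2 q} := by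
            simp only [uIcc, mem_Icc]
            exact (isClosed_le (by fun_prop) (by fun_prop)).inter
              (isClosed_le (by fun_prop) (by fun_prop))
          exact this.measurableSet
        have hF : Measurable fun y : (C(I, M) × I) × I =>
            {y : (C(I, M) × I) × I | y.2 ∈ uIcc y.1.2 q}.indicator
              (fun y => ENNReal.ofReal (G (y.1.1 y.2)) * metricSpeed y.1.1 y.2) y :=
          (hm.comp ((measurable_fst.comp measurable_fst).prodMk measurable_snd)).indicator hset
        convert hF.lintegral_prod_right' (ν := volume) using 2 with x
        rw [← lintegral_indicator measurableSet_uIcc]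
        rfl
  filter_upwards [hDall, hcomm, hπ.ae_lintegral_speed_lt_top hG.measurable hG.memLp]
    with γ h1 h2 h3
  have hfin : IsFiniteMeasure
      ((volume : Measure I).withDensity fun t => ENNReal.ofReal (G (γ t)) * metricSpeed γ t) :=
    isFiniteMeasure_withDensity h3.ne
  set μ := (volume : Measure I).withDensity
    fun t => ENNReal.ofReal (G (γ t)) * metricSpeed γ t with hμ
  have hac : μ ≪ volume := withDensity_absolutelyContinuous _ _
  have : NullSingletonClass μ := ⟨fun x => hac (by simp)⟩
  have hmu : ∀ t q : I, (μ (uIcc t q)).toReal = |μ.real (Iic t) - μ.real (Iic q)| := by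
    have key : ∀ t q : I, t ≤ q → (μ (uIcc t q)).toReal = μ.real (Iic q) - μ.real (Iic t) := by
      intro t q htq
      rw [uIcc_of_le htq, ← measureReal_sdiff (Iic_subset_Iic.2 htq) measurableSet_Iic, Iic_sdiff_Iic]
      exact congrArg _ (measure_congr Ioc_ae_eq_Icc).symm
    intro t q
    have hmono : ∀ a b : I, a ≤ b → μ.real (Iic a) ≤ μ.real (Iic b) := fun a b hab =>
      measureReal_mono (Iic_subset_Iic.2 hab)
    rcases le_total t q with h | h
    · rw [key t q h, abs_sub_comm, abs_of_nonneg (sub_nonneg.2 (hmono _ _ h))]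
    · rw [uIcc_comm, key q t h, abs_of_nonneg (sub_nonneg.2 (hmono _ _ h))]
  refine restrict_uIcc_le_map_of_increments μ (u := fun t => f (γ t)) (D := D)
    (E := {t | ∀ q ∈ D, ‖f (γ t) - f (γ q)‖ₑ ≤
      ∫⁻ r in uIcc t q, ENNReal.ofReal (G (γ r)) * metricSpeed γ r})
    hD (h1 0 (by simp [hDdef])) (h1 1 (by simp [hDdef])) (hac.ae_le h2) ?_
  intro t ht q hq
  rw [← hmu, Real.dist_eq, ← Real.norm_eq_abs, ← toReal_enorm]
  refine ENNReal.toReal_mono (measure_ne_top _ _) ?_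
  rw [hμ, withDensity_apply _ measurableSet_uIcc]
  exact ht q hq

/-- The chain rule for weak upper gradients. -/
theorem IsWeakUpperGradient.comp {M : Type*} [MetricSpace M] [SecondCountableTopology M]
    [MeasurableSpace M] [BorelSpace M] {m : Measure M} {f g : M →ₘ[m] ℝ} {G : M → ℝ}
    (hG : IsWeakUpperGradient m f G) {φ ρ : ℝ → ℝ} {K : ℝ} (hρ : Measurable ρ)
    (hK : ∀ t, |ρ t| ≤ K) (hφ : ∀ a b, φ b - φ a = ∫ t in a..b, ρ t)
    (hg : ∀ᵐ x ∂m, g x = φ (f x)) : IsWeakUpperGradient m g (fun x => |ρ (f x)| * G x) where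
  measurable := (hρ.comp f.measurable).abs.mul hG.measurable
  nonneg x := mul_nonneg (abs_nonneg _) (hG.nonneg x)
  memLp := by
    refine MemLp.of_le_mul (c := K) hG.memLp
      (((hρ.comp f.measurable).abs.mul hG.measurable).aestronglyMeasurable) (ae_of_all _ fun x => ?_)
    rw [norm_mul, Real.norm_eq_abs, abs_abs]
    exact mul_le_mul_of_nonneg_right (hK _) (norm_nonneg _)
  le := by
    intro π hπ
    refine lintegral_mono_ae ?_
    filter_upwards [hG.ae_restrict_uIcc_le_map hπ, hπ.ae_comp 0 hg, hπ.ae_comp 1 hg]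
      with γ h h0 h1
    have hfγ : Measurable fun t => f (γ t) := f.measurable.comp γ.continuous.measurable
    have hρe : Measurable fun y => ‖ρ y‖ₑ := hρ.enorm
    have hh : Measurable fun t => ENNReal.ofReal (G (γ t)) * metricSpeed γ t :=
      (measurable_mul_metricSpeed hG.measurable).comp measurable_prodMk_left
    calc ‖g (γ 1) - g (γ 0)‖ₑ = ‖∫ t in f (γ 0)..f (γ 1), ρ t‖ₑ := by rw [h0, h1, hφ]
      _ = ‖∫ t in uIoc (f (γ 0)) (f (γ 1)), ρ t‖ₑ := by
          rw [← enorm_norm, intervalIntegral.norm_intervalIntegral_eq, enorm_norm]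
      _ ≤ ∫⁻ t in uIoc (f (γ 0)) (f (γ 1)), ‖ρ t‖ₑ := enorm_integral_le_lintegral_enorm _
      _ ≤ ∫⁻ t in uIcc (f (γ 0)) (f (γ 1)), ‖ρ t‖ₑ :=
          lintegral_mono_set Ioc_subset_Icc_self
      _ ≤ ∫⁻ y, ‖ρ y‖ₑ ∂((volume.withDensity fun t => ENNReal.ofReal (G (γ t)) *
            metricSpeed γ t).map fun t => f (γ t)) := lintegral_mono' h le_rfl
      _ = ∫⁻ t, ENNReal.ofReal (G (γ t)) * metricSpeed γ t * ‖ρ (f (γ t))‖ₑ := by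
          rw [lintegral_map hρe hfγ, 
            lintegral_withDensity_eq_lintegral_mul _ hh (g := fun t => ‖ρ (f (γ t))‖ₑ)
              (hρe.comp hfγ)]
          rfl
      _ = _ := by
          refine lintegral_congr fun t => ?_
          rw [ENNReal.ofReal_mul (abs_nonneg _), Real.enorm_eq_ofReal_abs]
          ring

/-- A weak upper gradient of `f` may be taken to vanish on the preimage of a null set. -/
theorem IsWeakUpperGradient.indicator_compl {M : Type*} [MetricSpace M]
    [SecondCountableTopology M] [MeasurableSpace M] [BorelSpace M] {m : Measure M}
    {f : M →ₘ[m] ℝ} {G : M → ℝ} (hG : IsWeakUpperGradient m f G) {N : Set ℝ}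
    (hN : MeasurableSet N) (hN0 : volume N = 0) :
    IsWeakUpperGradient m f (fun x => |Nᶜ.indicator (fun _ => (1 : ℝ)) (f x)| * G x) := by
  -- The identity is still a primitive of the constant 1 after that constant is changed to 0 on the
  -- null set `N`.
  refine hG.comp (φ := id) (K := 1) (measurable_const.indicator hN.compl) (fun t => ?_)
    (fun a b => ?_) (ae_of_all _ fun x => rfl)
  · by_cases h : t ∈ Nᶜ <;> simp [h]
  · have : ∀ᵐ t, t ∈ uIoc a b → Nᶜ.indicator (fun _ => (1 : ℝ)) t = 1 := by
      filter_upwards [compl_mem_ae_iff.2 hN0] with t ht _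
      exact indicator_of_mem ht _
    rw [intervalIntegral.integral_congr_ae this]
    simp

/-! ### Modules over `L^∞(m)` -/

namespace LInftyModule

variable {M : Type*} [MeasurableSpace M] {m : Measure M} {V : Type*} [NormedAddCommGroup V]
  [NormedSpace ℝ V] [CompleteSpace V]

theorem coeFn_chi {A : Set M} (hA : MeasurableSet A) :
    LInfty.chi m hA =ᵐ[m] A.indicator fun _ => (1 : ℝ) :=
  MemLp.coeFn_toLp _

theorem coeFn_mul (f g : Lp ℝ ∞ m) : LInfty.mul f g =ᵐ[m] fun x => f x * g x :=
  AEEqFun.coeFn_mul f.1 g.1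

theorem norm_smul_le_of_ae_bound (𝒜 : LInftyModule m V) {η : Lp ℝ ∞ m} {K : ℝ} (hK : 0 ≤ K)
    (h : ∀ᵐ x ∂m, ‖η x‖ ≤ K) (v : V) : ‖𝒜.smul η v‖ ≤ K * ‖v‖ := by
  refine (𝒜.norm_smul_le _ _).trans (mul_le_mul_of_nonneg_right ?_ (norm_nonneg _))
  rw [Lp.norm_def]
  refine ENNReal.toReal_le_of_le_ofReal hK ?_
  rw [eLpNorm_exponent_top]
  exact eLpNormEssSup_le_of_ae_bound h

theorem norm_smul_chi_le (𝒜 : LInftyModule m V) {A : Set M} (hA : MeasurableSet A) (v : V) :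
    ‖𝒜.smul (LInfty.chi m hA) v‖ ≤ ‖v‖ := by
  rw [← one_mul ‖v‖]
  refine 𝒜.norm_smul_le_of_ae_bound zero_le_one ?_ v
  filter_upwards [coeFn_chi (m := m) hA] with x hx
  rw [hx]
  by_cases h : x ∈ A <;> simp [h]

theorem smul_eq_smul_smul_of_ae (𝒜 : LInftyModule m V) {η η₁ η₂ : Lp ℝ ∞ m}
    (h : ∀ᵐ x ∂m, η x = η₁ x * η₂ x) (v : V) : 𝒜.smul η v = 𝒜.smul η₁ (𝒜.smul η₂ v) := by
  rw [← 𝒜.mul_smul]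
  congr 2
  refine Lp.ext ?_
  filter_upwards [h, coeFn_mul η₁ η₂] with x h1 h2
  rw [h1, h2]

/-- If `v = 0` on `A` and `η = 0` outside of `A`, then `η v = 0`. -/
theorem smul_eq_zero_of_ae (𝒜 : LInftyModule m V) {A : Set M} (hA : MeasurableSet A)
    {η : Lp ℝ ∞ m} {v : V} (hv : 𝒜.smul (LInfty.chi m hA) v = 0)
    (h : ∀ᵐ x ∂m, x ∉ A → η x = 0) : 𝒜.smul η v = 0 := by
  rw [𝒜.smul_eq_smul_smul_of_ae (η₁ := η) (η₂ := LInfty.chi m hA), hv, map_zero]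
  filter_upwards [h, coeFn_chi (m := m) hA] with x h1 h2
  rw [h2]
  by_cases hx : x ∈ A <;> simp [hx, h1]

theorem smul_chi_eq_zero_mono (𝒜 : LInftyModule m V) {A B : Set M} (hA : MeasurableSet A)
    (hB : MeasurableSet B) {v : V} (hv : 𝒜.smul (LInfty.chi m hA) v = 0)
    (h : ∀ᵐ x ∂m, x ∈ B → x ∈ A) : 𝒜.smul (LInfty.chi m hB) v = 0 := by
  refine 𝒜.smul_eq_zero_of_ae hA hv ?_
  filter_upwards [h, coeFn_chi (m := m) hB] with x h1 h2 hx
  rw [h2]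
  exact indicator_of_notMem (fun hB => hx (h1 hB)) _

theorem smul_chi_smul_eq_zero (𝒜 : LInftyModule m V) {A : Set M} (hA : MeasurableSet A)
    {η : Lp ℝ ∞ m} (h : ∀ᵐ x ∂m, x ∈ A → η x = 0) (v : V) :
    𝒜.smul (LInfty.chi m hA) (𝒜.smul η v) = 0 := by
  rw [← 𝒜.smul_eq_smul_smul_of_ae (η := 0), map_zero, LinearMap.zero_apply]
  filter_upwards [h, coeFn_chi (m := m) hA, Lp.coeFn_zero ℝ ∞ m] with x h1 h2 h3
  rw [h2, h3]
  by_cases hx : x ∈ A <;> simp [hx, h1]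

theorem smul_chi_add_compl (𝒜 : LInftyModule m V) {A : Set M} (hA : MeasurableSet A) (v : V) :
    𝒜.smul (LInfty.chi m hA) v + 𝒜.smul (LInfty.chi m hA.compl) v = v := by
  conv_rhs => rw [← 𝒜.one_smul v]
  rw [← LinearMap.add_apply, ← map_add]
  congr 2
  refine Lp.ext ?_
  filter_upwards [coeFn_chi (m := m) hA, coeFn_chi (m := m) hA.compl,
    coeFn_chi (m := m) MeasurableSet.univ, Lp.coeFn_add (LInfty.chi m hA) (LInfty.chi m hA.compl)]
    with x h1 h2 h3 h4
  rw [h4, Pi.add_apply, h1, h2, h3]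
  by_cases hx : x ∈ A <;> simp [hx]

end LInftyModule

/-! ### Compositions with Lipschitz functions -/

/-- `u = φ ∘ f` where `φ` is a primitive of the bounded function `ρ`. -/
structure SobolevClass.HasDensity {M : Type*} [MetricSpace M] [MeasurableSpace M] [BorelSpace M]
    {m : Measure M} (f u : SobolevClass m) (ρ : ℝ → ℝ) : Prop where
  measurable : Measurable ρ
  bounded : ∃ K, ∀ t, |ρ t| ≤ K
  exists_primitive : ∃ φ : ℝ → ℝ, (∀ a b, φ b - φ a = ∫ t in a..b, ρ t) ∧
    ∀ᵐ x ∂m, u.1 x = φ (f.1 x)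

theorem intervalIntegrable_of_bounded {ρ : ℝ → ℝ} (hρ : Measurable ρ) {K : ℝ}
    (hK : ∀ t, |ρ t| ≤ K) (a b : ℝ) : IntervalIntegrable ρ volume a b :=
  (intervalIntegrable_const (c := K)).mono_fun' hρ.aestronglyMeasurable (ae_of_all _ hK)

namespace SobolevClass

/-- The measure `G² m`, transported by `f`. -/
noncomputable def gradientMeasure {M : Type*} [MeasurableSpace M] (m : Measure M)
    (f : M →ₘ[m] ℝ) (G : M → ℝ) : Measure ℝ :=
  (m.withDensity fun x => ENNReal.ofReal (G x) ^ 2).map f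

theorem lintegral_gradientMeasure {M : Type*} [MeasurableSpace M] {m : Measure M}
    {f : M →ₘ[m] ℝ} {G : M → ℝ} (hG : Measurable G)
    {g : ℝ → ℝ≥0∞} (hg : Measurable g) :
    ∫⁻ y, g y ∂gradientMeasure m f G = ∫⁻ x, ENNReal.ofReal (G x) ^ 2 * g (f x) ∂m := by
  rw [gradientMeasure, lintegral_map hg f.measurable,
    lintegral_withDensity_eq_lintegral_mul _ (hG.ennreal_ofReal.pow_const 2)
      (g := fun x => g (f x)) (hg.comp f.measurable)]
  rfl

theorem isFiniteMeasure_gradientMeasure {M : Type*} [MetricSpace M] [MeasurableSpace M]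
    {m : Measure M} {f : M →ₘ[m] ℝ} {G : M → ℝ}
    (hG : IsWeakUpperGradient m f G) : IsFiniteMeasure (gradientMeasure m f G) := by
  have : IsFiniteMeasure (m.withDensity fun x => ENNReal.ofReal (G x) ^ 2) := by
    refine isFiniteMeasure_withDensity (ne_of_lt ?_)
    refine lt_of_le_of_lt (lintegral_mono fun x => ?_)
      (lintegral_rpow_enorm_lt_top_of_eLpNorm_lt_top two_ne_zero ENNReal.ofNat_ne_top hG.memLp.2)
    simp only [ENNReal.toReal_ofNat, ENNReal.rpow_ofNat]
    gcongr
    rw [Real.enorm_eq_ofReal_abs]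
    exact ENNReal.ofReal_le_ofReal (le_abs_self _)
  unfold gradientMeasure
  infer_instance

variable {M : Type*} [MetricSpace M] [MeasurableSpace M] [BorelSpace M] {m : Measure M}

theorem HasDensity.intervalIntegrable {f u : SobolevClass m} {ρ : ℝ → ℝ}
    (h : HasDensity f u ρ) (a b : ℝ) : IntervalIntegrable ρ volume a b := by
  obtain ⟨K, hK⟩ := h.bounded
  exact intervalIntegrable_of_bounded h.measurable hK a b

theorem HasDensity.refl (f : SobolevClass m) : HasDensity f f (fun _ => 1) where
  measurable := measurable_const
  bounded := ⟨1, fun _ => by simp⟩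
  exists_primitive := ⟨id, fun a b => by simp, ae_of_all _ fun x => rfl⟩

theorem HasDensity.add {f u v : SobolevClass m} {ρ τ : ℝ → ℝ} (hu : HasDensity f u ρ)
    (hv : HasDensity f v τ) : HasDensity f (u + v) (fun t => ρ t + τ t) where
  measurable := hu.measurable.add hv.measurable
  bounded := by
    obtain ⟨K, hK⟩ := hu.bounded
    obtain ⟨K', hK'⟩ := hv.bounded
    exact ⟨K + K', fun t => (abs_add_le _ _).trans (add_le_add (hK t) (hK' t))⟩
  exists_primitive := by
    obtain ⟨φ, hφ, hφu⟩ := hu.exists_primitive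
    obtain ⟨χ, hχ, hχv⟩ := hv.exists_primitive
    refine ⟨fun t => φ t + χ t, fun a b => ?_, ?_⟩
    · rw [intervalIntegral.integral_add (hu.intervalIntegrable a b) (hv.intervalIntegrable a b),
        ← hφ, ← hχ]
      ring
    · filter_upwards [hφu, hχv, AEEqFun.coeFn_add u.1 v.1] with x h1 h2 h3
      rw [Submodule.coe_add, h3, Pi.add_apply, h1, h2]

theorem HasDensity.smul {f u : SobolevClass m} {ρ : ℝ → ℝ} (hu : HasDensity f u ρ) (c : ℝ) :
    HasDensity f (c • u) (fun t => c * ρ t) where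
  measurable := hu.measurable.const_mul c
  bounded := by
    obtain ⟨K, hK⟩ := hu.bounded
    refine ⟨|c| * K, fun t => ?_⟩
    rw [abs_mul]
    exact mul_le_mul_of_nonneg_left (hK t) (abs_nonneg c)
  exists_primitive := by
    obtain ⟨φ, hφ, hφu⟩ := hu.exists_primitive
    refine ⟨fun t => c * φ t, fun a b => ?_, ?_⟩
    · rw [intervalIntegral.integral_const_mul, ← hφ]
      ring
    · filter_upwards [hφu, AEEqFun.coeFn_smul c u.1] with x h1 h2
      rw [Submodule.coe_smul, h2, Pi.smul_apply, h1, smul_eq_mul]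

theorem HasDensity.sub {f u v : SobolevClass m} {ρ τ : ℝ → ℝ} (hu : HasDensity f u ρ)
    (hv : HasDensity f v τ) : HasDensity f (u - v) (fun t => ρ t - τ t) := by
  convert hu.add (hv.smul (-1)) using 1
  · module
  · ext t
    ring

theorem exists_primitive_comp (f : SobolevClass m) {φ ρ : ℝ → ℝ} (hρ : Measurable ρ) {K : ℝ}
    (hK : ∀ t, |ρ t| ≤ K) (hφ : ∀ a b, φ b - φ a = ∫ t in a..b, ρ t) :
    ∃ u : SobolevClass m, (∀ᵐ x ∂m, u.1 x = φ (f.1 x)) ∧ HasDensity f u ρ := by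
  have hK0 : 0 ≤ K := (abs_nonneg _).trans (hK 0)
  have hlip : LipschitzOnWith K.toNNReal φ univ := by
    refine LipschitzOnWith.of_dist_le_mul fun x _ y _ => ?_
    rw [Real.dist_eq, hφ, Real.coe_toNNReal K hK0, Real.dist_eq, ← Real.norm_eq_abs]
    exact intervalIntegral.norm_integral_le_of_norm_le_const fun t _ => hK t
  have hu := AEEqFun.coeFn_mk (fun x => φ (f.1 x))
    (aestronglyMeasurable_comp_of_lipschitzOnWith f.1 (U := univ) (by simp) hlip)
  exact ⟨SobolevClass.comp f (U := univ) (by simp) hlip, hu, hρ, ⟨K, hK⟩, φ, hφ, hu⟩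

theorem exists_hasDensity (f : SobolevClass m) {ρ : ℝ → ℝ} (hρ : Measurable ρ) {K : ℝ}
    (hK : ∀ t, |ρ t| ≤ K) : ∃ u : SobolevClass m,
      (∀ᵐ x ∂m, u.1 x = ∫ t in (0 : ℝ)..f.1 x, ρ t) ∧ HasDensity f u ρ :=
  exists_primitive_comp f (φ := fun x => ∫ t in (0 : ℝ)..x, ρ t) hρ hK fun _ _ =>
    intervalIntegral.integral_interval_sub_left (intervalIntegrable_of_bounded hρ hK _ _)
      (intervalIntegrable_of_bounded hρ hK _ _)

/-- For every null set `N`, some weak upper gradient of `f` vanishes on `f⁻¹(N)`. -/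
theorem exists_gradientMeasure_eq_zero [SecondCountableTopology M] (f : SobolevClass m)
    {N : Set ℝ} (hN : MeasurableSet N) (hN0 : volume N = 0) :
    ∃ G, IsWeakUpperGradient m f.1 G ∧ gradientMeasure m f.1 G N = 0 := by
  obtain ⟨G, hG⟩ := f.2
  have hG' := hG.indicator_compl hN hN0
  refine ⟨_, hG', ?_⟩
  rw [← setLIntegral_one, ← lintegral_indicator hN,
    lintegral_gradientMeasure hG'.measurable (measurable_const.indicator hN), lintegral_eq_zero_iff']
  · refine ae_of_all _ fun x => ?_
    by_cases hx : f.1 x ∈ N <;> simp [hx]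
  · exact ((hG'.measurable.ennreal_ofReal.pow_const 2).mul
      ((measurable_const.indicator hN).comp f.1.measurable)).aemeasurable

/-! ### The fundamental estimate for `L` -/

variable {V : Type*} [NormedAddCommGroup V] [NormedSpace ℝ V]

theorem norm_le_of_isWeakUpperGradient {L : SobolevClass m →ₗ[ℝ] V} {C : ℝ} (hC : 0 < C)
    (hL : ∀ f : SobolevClass m, ‖L f‖ ≤ C * √(∫ x, minimalWeakUpperGradient m f.1 x ^ 2 ∂m))
    {f : SobolevClass m} {G : M → ℝ} (hG : IsWeakUpperGradient m f.1 G) :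
    ‖L f‖ₑ ^ 2 ≤ ENNReal.ofReal C ^ 2 * ∫⁻ x, ENNReal.ofReal (G x) ^ 2 ∂m := by
  have hint : Integrable (fun x => G x ^ 2) m := hG.memLp.integrable_sq
  have h1 : ‖L f‖ ≤ C * √(∫ x, G x ^ 2 ∂m) := by
    refine (hL f).trans (mul_le_mul_of_nonneg_left (Real.sqrt_le_sqrt ?_) hC.le)
    by_cases h : ∃ G, IsMinimalWeakUpperGradient m f.1 G
    · rw [minimalWeakUpperGradient, dif_pos h]
      refine integral_mono_of_nonneg (ae_of_all _ fun x => sq_nonneg _) hint ?_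
      filter_upwards [h.choose_spec.2 G hG] with x hx
      exact pow_le_pow_left₀ (h.choose_spec.1.nonneg x) hx 2
    -- Without a minimal weak upper gradient the default value is 0, which is below any `G`.
    · rw [minimalWeakUpperGradient, dif_neg h]
      simpa using integral_nonneg fun x => sq_nonneg (G x)
  have h2 : ‖L f‖ ^ 2 ≤ C ^ 2 * ∫ x, G x ^ 2 ∂m := by
    have := pow_le_pow_left₀ (norm_nonneg _) h1 2
    rwa [mul_pow, Real.sq_sqrt (integral_nonneg fun x => sq_nonneg (G x))] at this
  rw [← ofReal_norm, ← ENNReal.ofReal_pow (norm_nonneg _), ← ENNReal.ofReal_pow hC.le]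
  refine (ENNReal.ofReal_le_ofReal h2).trans_eq ?_
  rw [ENNReal.ofReal_mul (sq_nonneg C), ofReal_integral_eq_lintegral_ofReal hint
    (ae_of_all _ fun x => sq_nonneg _)]
  simp_rw [ENNReal.ofReal_pow (hG.nonneg _)]

theorem HasDensity.enorm_sq_le [SecondCountableTopology M] {L : SobolevClass m →ₗ[ℝ] V} {C : ℝ}
    (hC : 0 < C)
    (hL : ∀ f : SobolevClass m, ‖L f‖ ≤ C * √(∫ x, minimalWeakUpperGradient m f.1 x ^ 2 ∂m))
    {f u : SobolevClass m} {ρ : ℝ → ℝ} (h : HasDensity f u ρ) {G : M → ℝ}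
    (hG : IsWeakUpperGradient m f.1 G) :
    ‖L u‖ₑ ^ 2 ≤ ENNReal.ofReal C ^ 2 * ∫⁻ y, ‖ρ y‖ₑ ^ 2 ∂gradientMeasure m f.1 G := by
  obtain ⟨K, hK⟩ := h.bounded
  obtain ⟨φ, hφ, hu⟩ := h.exists_primitive
  refine (norm_le_of_isWeakUpperGradient hC hL (hG.comp h.measurable hK hφ hu)).trans_eq ?_
  rw [lintegral_gradientMeasure hG.measurable (h.measurable.enorm.pow_const 2)]
  congr 1
  refine lintegral_congr fun x => ?_
  rw [ENNReal.ofReal_mul (abs_nonneg _), Real.enorm_eq_ofReal_abs]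
  ring

/-- The difference has density 0, so the estimate gives `L(u - v) = 0`. Additive constants in the
primitive are thus irrelevant. -/
theorem HasDensity.map_eq_map [SecondCountableTopology M] {L : SobolevClass m →ₗ[ℝ] V} {C : ℝ}
    (hC : 0 < C)
    (hL : ∀ f : SobolevClass m, ‖L f‖ ≤ C * √(∫ x, minimalWeakUpperGradient m f.1 x ^ 2 ∂m))
    {f u v : SobolevClass m} {ρ : ℝ → ℝ} (hu : HasDensity f u ρ) (hv : HasDensity f v ρ) :
    L u = L v := by
  obtain ⟨G, hG⟩ := f.2
  have := (hu.sub hv).enorm_sq_le hC hL hG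
  rw [← sub_eq_zero, ← map_sub]
  simpa using this

/-- The constant functions, as elements of the Sobolev class, are annihilated by `L`. -/
theorem exists_const_map_eq_zero [SecondCountableTopology M] {L : SobolevClass m →ₗ[ℝ] V} {C : ℝ}
    (hC : 0 < C)
    (hL : ∀ f : SobolevClass m, ‖L f‖ ≤ C * √(∫ x, minimalWeakUpperGradient m f.1 x ^ 2 ∂m))
    (c : ℝ) : ∃ u : SobolevClass m, (∀ᵐ x ∂m, u.1 x = c) ∧ L u = 0 := by
  obtain ⟨u, hu, hd⟩ := exists_primitive_comp (0 : SobolevClass m) (φ := fun _ => c)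
    (ρ := fun _ => 0) measurable_const (K := 0) (by simp) (by simp)
  obtain ⟨G, hG⟩ := (0 : SobolevClass m).2
  refine ⟨u, hu, ?_⟩
  simpa using hd.enorm_sq_le hC hL hG

end SobolevClass

/-! ### Locality implies the chain rule -/

namespace LInftyModule

open SobolevClass

variable {M : Type*} [MetricSpace M] [SecondCountableTopology M] [MeasurableSpace M]
  [BorelSpace M] {m : Measure M} {V : Type*} [NormedAddCommGroup V] [NormedSpace ℝ V]
  [CompleteSpace V] {𝒜 : LInftyModule m V} {L : SobolevClass m →ₗ[ℝ] V} {C : ℝ}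

/-- The primitive `φ` is constant on each ball inside `U`, and each ball contains a rational `q`.
Hence `f⁻¹(U)` is covered, up to a null set, by the countably many sets `{u = φ(q)}`, on each of
which `L u` agrees with `L` of a constant, that is, with 0. The locality axiom of the module joins
these sets. -/
theorem LocalityRule.smul_chi_eq_zero_of_isOpen (hloc : 𝒜.LocalityRule L) (hC : 0 < C)
    (hL : ∀ f : SobolevClass m, ‖L f‖ ≤ C * √(∫ x, minimalWeakUpperGradient m f.1 x ^ 2 ∂m))
    {f u : SobolevClass m} {ρ : ℝ → ℝ} (h : HasDensity f u ρ) {U : Set ℝ} (hU : IsOpen U)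
    (hρU : ∀ t ∈ U, ρ t = 0) :
    𝒜.smul (LInfty.chi m (f.1.measurable hU.measurableSet)) (L u) = 0 := by
  obtain ⟨φ, hφ, hu⟩ := h.exists_primitive
  obtain ⟨e, he⟩ := exists_surjective_nat ℚ
  choose c hc hLc using fun n => exists_const_map_eq_zero hC hL (φ (e n))
  have hA : ∀ n, MeasurableSet {x | u.1 x = (c n).1 x} := fun n =>
    measurableSet_eq_fun u.1.measurable (c n).1.measurable
  have key := 𝒜.locality (L u) _ hA fun n => by
    have := hloc u (c n)
    rwa [EqOn, hLc, sub_zero] at this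
  refine 𝒜.smul_chi_eq_zero_mono _ _ key ?_
  filter_upwards [hu, ae_all_iff.2 hc] with x hx hcx hxU
  obtain ⟨ε, hε, hball⟩ := Metric.isOpen_iff.1 hU _ hxU
  obtain ⟨q, hq⟩ := (Rat.denseRange_cast (𝕜 := ℝ)).exists_dist_lt (f.1 x) hε
  obtain ⟨n, rfl⟩ := he q
  refine mem_iUnion.2 ⟨n, ?_⟩
  rw [mem_ofPred_eq, hx, hcx, ← sub_eq_zero, hφ]
  refine intervalIntegral.integral_zero_ae (ae_of_all _ fun t ht => hρU t (hball ?_))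
  have hconv := (convex_ball (f.1 x) ε).ordConnected.uIcc_subset (Metric.mem_ball'.2 hq)
    (Metric.mem_ball_self hε)
  exact hconv (uIoc_subset_uIcc ht)

/-- Under locality, `L(φ ∘ f)` vanishes on `f⁻¹(B)` if `φ' ∘ f |Df|` does. -/
theorem LocalityRule.smul_chi_eq_zero (hloc : 𝒜.LocalityRule L) (hC : 0 < C)
    (hL : ∀ f : SobolevClass m, ‖L f‖ ≤ C * √(∫ x, minimalWeakUpperGradient m f.1 x ^ 2 ∂m))
    {f u : SobolevClass m} {ρ : ℝ → ℝ} (h : HasDensity f u ρ) {G : M → ℝ}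
    (hG : IsWeakUpperGradient m f.1 G) {B : Set ℝ} (hB : MeasurableSet B)
    (hρB : ∫⁻ y in B, ‖ρ y‖ₑ ^ 2 ∂gradientMeasure m f.1 G = 0) :
    𝒜.smul (LInfty.chi m (f.1.measurable hB)) (L u) = 0 := by
  have := isFiniteMeasure_gradientMeasure hG
  obtain ⟨K, hK⟩ := h.bounded
  set ν := gradientMeasure m f.1 G
  have hρ2 : Measurable fun y => ‖ρ y‖ₑ ^ 2 := h.measurable.enorm.pow_const 2
  have : IsFiniteMeasure (ν.withDensity fun y => ‖ρ y‖ₑ ^ 2) := by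
    refine isFiniteMeasure_withDensity (ne_of_lt ?_)
    calc ∫⁻ y, ‖ρ y‖ₑ ^ 2 ∂ν ≤ ∫⁻ _, ENNReal.ofReal K ^ 2 ∂ν := by
          refine lintegral_mono fun y => ?_
          gcongr
          rw [Real.enorm_eq_ofReal_abs]
          exact ENNReal.ofReal_le_ofReal (hK y)
      _ < ∞ := by
          rw [lintegral_const]
          exact ENNReal.mul_lt_top (by simp) (measure_lt_top _ _)
  have hle : ∀ ε : ℝ≥0∞, 0 < ε → ‖𝒜.smul (LInfty.chi m (f.1.measurable hB)) (L u)‖ₑ ^ 2 ≤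
      ENNReal.ofReal C ^ 2 * ε := by
    intro ε hε
    -- Outer regularity of `|ρ|² ν`: some open `U ⊇ B` has mass less than `ε`. With `v` of density
    -- `χ_U ρ`, `L u = L v` on `f⁻¹(U)`, and `L v` is small by the estimate.
    obtain ⟨U, hBU, hU, hlt⟩ := B.exists_isOpen_lt_add (μ := ν.withDensity fun y => ‖ρ y‖ₑ ^ 2)
      (measure_ne_top _ _) hε.ne'
    rw [withDensity_apply _ hB, hρB, zero_add, withDensity_apply _ hU.measurableSet] at hlt
    obtain ⟨v, -, hv⟩ := exists_hasDensity f (h.measurable.indicator hU.measurableSet) (K := K)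
      fun t => by
        by_cases ht : t ∈ U
        · simpa [ht] using hK t
        · simpa [ht] using (abs_nonneg _).trans (hK t)
    have h0 := hloc.smul_chi_eq_zero_of_isOpen hC hL (h.sub hv) hU fun t ht => by simp [ht]
    have h1 := 𝒜.smul_chi_eq_zero_mono _ (f.1.measurable hB) h0 (ae_of_all _ fun x hx => hBU hx)
    rw [map_sub, map_sub, sub_eq_zero] at h1
    rw [h1]
    calc ‖𝒜.smul (LInfty.chi m (f.1.measurable hB)) (L v)‖ₑ ^ 2 ≤ ‖L v‖ₑ ^ 2 := by
          gcongr
          exact enorm_le_iff_norm_le.2 (𝒜.norm_smul_chi_le _ _)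
      _ ≤ _ := hv.enorm_sq_le hC hL hG
      _ ≤ _ := by
          gcongr
          refine le_trans (le_of_eq ?_) hlt.le
          rw [← lintegral_indicator hU.measurableSet]
          refine lintegral_congr fun y => ?_
          by_cases hy : y ∈ U <;> simp [hy]
  have hlim : Tendsto (fun ε => ENNReal.ofReal C ^ 2 * ε) (𝓝[>] 0) (𝓝 (ENNReal.ofReal C ^ 2 * 0)) :=
    (ENNReal.Tendsto.const_mul tendsto_id (Or.inr (by simp))).mono_left nhdsWithin_le_nhds
  have := ge_of_tendsto hlim (eventually_nhdsWithin_of_forall fun ε hε => hle ε hε)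
  simpa using this

theorem LocalityRule.map_eq_smul_indicator (hloc : 𝒜.LocalityRule L) (hC : 0 < C)
    (hL : ∀ f : SobolevClass m, ‖L f‖ ≤ C * √(∫ x, minimalWeakUpperGradient m f.1 x ^ 2 ∂m))
    {f u : SobolevClass m} {B : Set ℝ} (hB : MeasurableSet B)
    (h : HasDensity f u (B.indicator fun _ => 1)) :
    L u = 𝒜.smul (LInfty.chi m (f.1.measurable hB)) (L f) := by
  obtain ⟨G, hG⟩ := f.2
  -- The density of `f - u` vanishes on `B` and that of `u` on `Bᶜ`, so `L u` equals `L f` over `B`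
  -- and 0 over `Bᶜ`.
  have h1 := hloc.smul_chi_eq_zero hC hL ((HasDensity.refl f).sub h) hG hB (by
    rw [← lintegral_indicator hB]
    refine (lintegral_congr fun y => ?_).trans lintegral_zero
    by_cases hy : y ∈ B <;> simp [hy])
  have h2 := hloc.smul_chi_eq_zero hC hL h hG hB.compl (by
    rw [← lintegral_indicator hB.compl]
    refine (lintegral_congr fun y => ?_).trans lintegral_zero
    by_cases hy : y ∈ B <;> simp [hy])
  rw [map_sub, map_sub, sub_eq_zero] at h1
  rw [h1, ← 𝒜.smul_chi_add_compl (f.1.measurable hB) (L u)]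
  have h3 : 𝒜.smul (LInfty.chi m (f.1.measurable hB).compl) (L u) = 0 := h2
  rw [h3, add_zero, ← 𝒜.smul_eq_smul_smul_of_ae]
  filter_upwards [coeFn_chi (m := m) (f.1.measurable hB)] with x hx
  rw [hx]
  by_cases hy : x ∈ f.1 ⁻¹' B <;> simp [hy]

theorem LocalityRule.map_eq_smul_simpleFunc (hloc : 𝒜.LocalityRule L) (hC : 0 < C)
    (hL : ∀ f : SobolevClass m, ‖L f‖ ≤ C * √(∫ x, minimalWeakUpperGradient m f.1 x ^ 2 ∂m))
    {f : SobolevClass m} (s : SimpleFunc ℝ ℝ) : ∀ (u : SobolevClass m) (η : Lp ℝ ∞ m),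
      HasDensity f u s → (∀ᵐ x ∂m, η x = s (f.1 x)) → L u = 𝒜.smul η (L f) := by
  induction s using SimpleFunc.induction with
  | @const c B hB =>
    intro u η hu hη
    obtain ⟨v, -, hv⟩ := exists_hasDensity f (measurable_const.indicator hB)
      (ρ := B.indicator fun _ => 1) (K := 1) fun t => by
        by_cases ht : t ∈ B <;> simp [ht]
    have h1 : HasDensity f (c • v) (SimpleFunc.piecewise B hB (SimpleFunc.const ℝ c)
        (SimpleFunc.const ℝ 0)) := by
      convert hv.smul c using 1
      ext t
      by_cases ht : t ∈ B <;> simp [ht]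
    rw [hu.map_eq_map hC hL h1, map_smul, hloc.map_eq_smul_indicator hC hL hB hv,
      ← LinearMap.smul_apply, ← map_smul]
    congr 2
    refine Lp.ext ?_
    filter_upwards [hη, Lp.coeFn_smul c (LInfty.chi m (f.1.measurable hB)),
      coeFn_chi (m := m) (f.1.measurable hB)] with x h1 h2 h3
    rw [h1, h2, Pi.smul_apply, h3]
    by_cases ht : f.1 x ∈ B <;> simp [ht]
  | @add s₁ s₂ _ ih₁ ih₂ =>
    intro u η hu hη
    obtain ⟨K₁, hK₁⟩ := s₁.exists_forall_norm_le
    obtain ⟨K₂, hK₂⟩ := s₂.exists_forall_norm_le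
    obtain ⟨u₁, -, hu₁⟩ := exists_hasDensity f s₁.measurable hK₁
    obtain ⟨u₂, -, hu₂⟩ := exists_hasDensity f s₂.measurable hK₂
    have hm₁ : MemLp (fun x => s₁ (f.1 x)) ∞ m := memLp_top_of_bound
      (s₁.measurable.comp f.1.measurable).aestronglyMeasurable K₁ (ae_of_all _ fun x => hK₁ _)
    have hm₂ : MemLp (fun x => s₂ (f.1 x)) ∞ m := memLp_top_of_bound
      (s₂.measurable.comp f.1.measurable).aestronglyMeasurable K₂ (ae_of_all _ fun x => hK₂ _)
    rw [hu.map_eq_map hC hL (hu₁.add hu₂), map_add, ih₁ u₁ (hm₁.toLp _) hu₁ hm₁.coeFn_toLp,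
      ih₂ u₂ (hm₂.toLp _) hu₂ hm₂.coeFn_toLp, ← LinearMap.add_apply, ← map_add]
    congr 2
    refine Lp.ext ?_
    filter_upwards [hη, hm₁.coeFn_toLp, hm₂.coeFn_toLp,
      Lp.coeFn_add (hm₁.toLp _) (hm₂.toLp _)] with x h1 h2 h3 h4
    rw [h4, Pi.add_apply, h1, h2, h3]
    rfl

end LInftyModule

theorem exists_simpleFunc_abs_sub_le {ρ : ℝ → ℝ} (hρ : Measurable ρ) {K : ℝ}
    (hK : ∀ t, |ρ t| ≤ K) {ε : ℝ} (hε : 0 < ε) :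
    ∃ s : SimpleFunc ℝ ℝ, ∀ t, |ρ t - s t| ≤ ε := by
  have hm : Measurable fun t => ε * (⌊ρ t / ε⌋ : ℝ) :=
    measurable_const.mul (measurable_from_top.comp (hρ.div_const ε).floor)
  refine ⟨⟨fun t => ε * (⌊ρ t / ε⌋ : ℝ), fun x => hm (measurableSet_singleton x), ?_⟩, fun t => ?_⟩
  · refine ((finite_Icc ⌊-K / ε⌋ ⌊K / ε⌋).image fun z : ℤ => ε * (z : ℝ)).subset ?_
    rintro _ ⟨t, rfl⟩
    obtain ⟨h1, h2⟩ := abs_le.1 (hK t)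
    exact ⟨_, ⟨Int.floor_mono (by gcongr), Int.floor_mono (by gcongr)⟩, rfl⟩
  · have h1 := Int.floor_le (ρ t / ε)
    have h2 := Int.lt_floor_add_one (ρ t / ε)
    have h3 : ρ t = ε * (ρ t / ε) := by field_simp
    change |ρ t - ε * (⌊ρ t / ε⌋ : ℝ)| ≤ ε
    rw [abs_of_nonneg] <;> nlinarith

namespace LInftyModule

open SobolevClass

variable {M : Type*} [MetricSpace M] [SecondCountableTopology M] [MeasurableSpace M]
  [BorelSpace M] {m : Measure M} {V : Type*} [NormedAddCommGroup V] [NormedSpace ℝ V]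
  [CompleteSpace V] {𝒜 : LInftyModule m V} {L : SobolevClass m →ₗ[ℝ] V} {C : ℝ}

/-- A simple function within `ε` of `ρ` changes `L u` by at most `C √(ν(ℝ)) ε` and `η L(f)` by at
most `ε ‖L f‖`. -/
theorem LocalityRule.map_eq_smul (hloc : 𝒜.LocalityRule L) (hC : 0 < C)
    (hL : ∀ f : SobolevClass m, ‖L f‖ ≤ C * √(∫ x, minimalWeakUpperGradient m f.1 x ^ 2 ∂m))
    {f u : SobolevClass m} {ρ : ℝ → ℝ} (hu : HasDensity f u ρ) {η : Lp ℝ ∞ m}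
    (hη : ∀ᵐ x ∂m, η x = ρ (f.1 x)) : L u = 𝒜.smul η (L f) := by
  obtain ⟨G, hG⟩ := f.2
  obtain ⟨K, hK⟩ := hu.bounded
  have := isFiniteMeasure_gradientMeasure hG
  set ν := gradientMeasure m f.1 G
  have hle : ∀ ε : ℝ, 0 < ε → ‖L u - 𝒜.smul η (L f)‖ ≤ (C * √(ν.real univ) + ‖L f‖) * ε := by
    intro ε hε
    obtain ⟨s, hs⟩ := exists_simpleFunc_abs_sub_le hu.measurable hK hε
    obtain ⟨K', hK'⟩ := s.exists_forall_norm_le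
    obtain ⟨v, -, hv⟩ := exists_hasDensity f s.measurable hK'
    have hm : MemLp (fun x => s (f.1 x)) ∞ m := memLp_top_of_bound
      (s.measurable.comp f.1.measurable).aestronglyMeasurable K' (ae_of_all _ fun x => hK' _)
    have h1 : ‖L (u - v)‖ ≤ C * √(ν.real univ) * ε := by
      have h := (hu.sub hv).enorm_sq_le hC hL hG
      have h' : ‖L (u - v)‖ₑ ^ 2 ≤ ENNReal.ofReal C ^ 2 * (ENNReal.ofReal ε ^ 2 * ν univ) := by
        refine h.trans ?_
        gcongr
        rw [← lintegral_const]
        refine lintegral_mono fun y => ?_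
        gcongr
        rw [Real.enorm_eq_ofReal_abs]
        exact ENNReal.ofReal_le_ofReal (hs y)
      refine abs_le_of_sq_le_sq' ?_ (by positivity) |>.2
      rw [mul_pow, mul_pow, Real.sq_sqrt measureReal_nonneg]
      have h2 := ENNReal.toReal_mono (by finiteness) h'
      simp only [ENNReal.toReal_pow, ENNReal.toReal_mul, toReal_enorm, ENNReal.toReal_ofReal hC.le,
        ENNReal.toReal_ofReal hε.le] at h2
      refine h2.trans_eq ?_
      rw [Measure.real]
      ring
    have h2 : ‖𝒜.smul (hm.toLp _ - η) (L f)‖ ≤ ε * ‖L f‖ := by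
      refine 𝒜.norm_smul_le_of_ae_bound hε.le ?_ _
      filter_upwards [hη, hm.coeFn_toLp, Lp.coeFn_sub (hm.toLp _) η] with x h1 h2 h3
      rw [h3, Pi.sub_apply, h1, h2, norm_sub_rev]
      exact hs _
    have h3 := hloc.map_eq_smul_simpleFunc hC hL s v _ hv hm.coeFn_toLp
    calc ‖L u - 𝒜.smul η (L f)‖ = ‖L (u - v) + 𝒜.smul (hm.toLp _ - η) (L f)‖ := by
          rw [map_sub, map_sub, LinearMap.sub_apply, h3]
          congr 1
          abel
      _ ≤ _ := norm_add_le _ _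
      _ ≤ _ := by linarith
  have hlim : Tendsto (fun ε => (C * √(ν.real univ) + ‖L f‖) * ε) (𝓝[>] 0)
      (𝓝 ((C * √(ν.real univ) + ‖L f‖) * 0)) :=
    (tendsto_id.const_mul _).mono_left nhdsWithin_le_nhds
  have := ge_of_tendsto hlim (eventually_nhdsWithin_of_forall fun ε hε => hle ε hε)
  rw [mul_zero] at this
  exact sub_eq_zero.1 (norm_le_zero_iff.1 this)

theorem LocalityRule.smul_chi_preimage_null (hloc : 𝒜.LocalityRule L) (hC : 0 < C)
    (hL : ∀ f : SobolevClass m, ‖L f‖ ≤ C * √(∫ x, minimalWeakUpperGradient m f.1 x ^ 2 ∂m))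
    (f : SobolevClass m) {N : Set ℝ} (hN : MeasurableSet N) (hN0 : volume N = 0) :
    𝒜.smul (LInfty.chi m (f.1.measurable hN)) (L f) = 0 := by
  obtain ⟨G, hG, hG0⟩ := exists_gradientMeasure_eq_zero f hN hN0
  exact hloc.smul_chi_eq_zero hC hL (HasDensity.refl f) hG hN (by simp [hG0])

theorem LocalityRule.chainRule (hloc : 𝒜.LocalityRule L) (hC : 0 < C)
    (hL : ∀ f : SobolevClass m, ‖L f‖ ≤ C * √(∫ x, minimalWeakUpperGradient m f.1 x ^ 2 ∂m)) :
    𝒜.ChainRule L := by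
  refine fun f => ⟨fun N hN hN0 => ?_, fun U φ K hU hfU hφ ψ hψ => ?_⟩
  · rw [EqOn, sub_zero]
    exact hloc.smul_chi_preimage_null hC hL f hN hN0
  obtain ⟨g, hg, hgU⟩ := hφ.extend_real
  have hfU' : ∀ᵐ x ∂m, f.1 x ∈ U := by
    rw [ae_iff]
    exact hfU
  have hbound : ∀ t, |deriv g t| ≤ K := fun t => norm_deriv_le_of_lipschitz hg
  have hd : HasDensity f (SobolevClass.comp f hfU hφ) (deriv g) := by
    refine ⟨measurable_deriv g, ⟨K, hbound⟩, g, fun a b => ?_, ?_⟩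
    · exact (hg.lipschitzOnWith.absolutelyContinuousOnInterval).integral_deriv_eq_sub.symm
    · filter_upwards [hfU', AEEqFun.coeFn_mk (fun x => φ (f.1 x))
        (aestronglyMeasurable_comp_of_lipschitzOnWith f.1 hfU hφ)] with x h1 h2
      exact h2.trans (hgU h1)
  have hm : MemLp (fun x => deriv g (f.1 x)) ∞ m := memLp_top_of_bound
    ((measurable_deriv g).comp f.1.measurable).aestronglyMeasurable K (ae_of_all _ fun x => hbound _)
  rw [hloc.map_eq_smul hC hL hd hm.coeFn_toLp, ← sub_eq_zero, ← LinearMap.sub_apply, ← map_sub]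
  -- By Rademacher's theorem the extension `g` fails to be differentiable only on a null set, over
  -- which `L f` vanishes. Elsewhere `φ = g` near `f(x) ∈ U`, so `ψ` is the derivative of `g`.
  have hN : MeasurableSet {t | DifferentiableAt ℝ g t}ᶜ :=
    (measurableSet_of_differentiableAt ℝ g).compl
  refine 𝒜.smul_eq_zero_of_ae _ (hloc.smul_chi_preimage_null hC hL f hN hg.ae_differentiableAt_real)
    ?_
  filter_upwards [hψ, hfU', hm.coeFn_toLp, Lp.coeFn_sub (hm.toLp _) ψ] with x h1 h2 h3 h4 hx
  have hdiff : DifferentiableAt ℝ g (f.1 x) := by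
    by_contra hcon
    exact hx hcon
  have heq : φ =ᶠ[𝓝 (f.1 x)] g := hgU.eventuallyEq_of_mem (hU.mem_nhds h2)
  rw [h4, Pi.sub_apply, h3, h1 (hdiff.congr_of_eventuallyEq heq), heq.deriv_eq, sub_self]

end LInftyModule

theorem exists_ae_abs_le_of_mem_Lp {M : Type*} [MeasurableSpace M] {m : Measure M}
    {f : M →ₘ[m] ℝ} (hf : f ∈ Lp ℝ ∞ m) : ∃ A, ∀ᵐ x ∂m, |f x| ≤ A := by
  have h : eLpNormEssSup f m < ∞ := by
    have := (Lp.mem_Lp_iff_memLp.1 hf).2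
    rwa [eLpNorm_exponent_top] at this
  refine ⟨(eLpNormEssSup f m).toReal, ?_⟩
  filter_upwards [ae_le_eLpNormEssSup (f := f) (μ := m)] with x hx
  rw [← Real.norm_eq_abs, ← toReal_enorm]
  exact ENNReal.toReal_mono h.ne hx

/-! ### Truncations under the Leibniz rule; the chain rule implies the Leibniz rule -/

namespace LInftyModule

open SobolevClass

variable {M : Type*} [MetricSpace M] [MeasurableSpace M]
  [BorelSpace M] {m : Measure M} {V : Type*} [NormedAddCommGroup V] [NormedSpace ℝ V]
  [CompleteSpace V] {𝒜 : LInftyModule m V} {L : SobolevClass m →ₗ[ℝ] V}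

theorem localityRule_of_smul_chi_eq_zero
    (h : ∀ f : SobolevClass m,
      𝒜.smul (LInfty.chi m (f.1.measurable (measurableSet_singleton (0 : ℝ)))) (L f) = 0) :
    𝒜.LocalityRule L := by
  intro f g
  rw [EqOn, ← map_sub]
  refine 𝒜.smul_chi_eq_zero_mono _ _ (h (f - g)) ?_
  filter_upwards [AEEqFun.coeFn_sub f.1 g.1] with x hx hfg
  have hfg' : f.1 x = g.1 x := hfg
  rw [mem_preimage, Submodule.coe_sub, hx, Pi.sub_apply, hfg', sub_self]
  exact mem_singleton 0

/-- Under the Leibniz rule, `L(φ ∘ h) = 0` on `{h = 0}` if `φ' = χ_B` with `B` bounded and away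
from the origin and `φ(0) = 0`. -/
theorem LeibnizRule.exists_hasDensity_smul_chi_eq_zero (hleib : 𝒜.LeibnizRule L)
    (h : SobolevClass m) {a b : ℝ} (ha : 0 < a) :
    ∃ u, HasDensity h u ({t : ℝ | a < |t| ∧ |t| < b}.indicator fun _ => 1) ∧
      𝒜.smul (LInfty.chi m (h.1.measurable (measurableSet_singleton (0 : ℝ)))) (L u) = 0 := by
  set B := {t : ℝ | a < |t| ∧ |t| < b}
  have hB : MeasurableSet B := (measurableSet_lt measurable_const measurable_abs).inter
    (measurableSet_lt measurable_abs measurable_const)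
  obtain ⟨u, hu, hd⟩ := exists_hasDensity h (ρ := B.indicator fun _ => 1) (K := 1)
    (measurable_const.indicator hB) fun t => by by_cases ht : t ∈ B <;> simp [ht]
  refine ⟨u, hd, ?_⟩
  have hθ0 : ∀ s : ℝ, |s| ≤ a → ∫ t in (0 : ℝ)..s, B.indicator (fun _ => (1 : ℝ)) t = 0 := by
    intro s hs
    refine intervalIntegral.integral_zero_ae (ae_of_all _ fun t ht => indicator_of_notMem ?_ _)
    intro htB
    have h1 : |t - 0| ≤ |s - 0| := abs_sub_left_of_mem_uIcc (uIoc_subset_uIcc ht)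
    rw [sub_zero, sub_zero] at h1
    exact absurd htB.1 (not_lt.2 (h1.trans hs))
  have hBfin : volume B < ∞ := by
    refine (measure_mono (t := Icc (-b) b) fun t ht => ?_).trans_lt measure_Icc_lt_top
    exact abs_le.1 ht.2.le
  have hθb : ∀ s : ℝ, ‖∫ t in (0 : ℝ)..s, B.indicator (fun _ => (1 : ℝ)) t‖ ≤ volume.real B := by
    intro s
    rw [intervalIntegral.norm_intervalIntegral_eq]
    refine (norm_integral_le_integral_norm _).trans ?_
    have hint : Integrable (fun t => ‖B.indicator (fun _ => (1 : ℝ)) t‖) :=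
      ((integrable_indicator_iff hB).2 (integrableOn_const hBfin.ne)).norm
    refine (setIntegral_le_integral hint (ae_of_all _ fun _ => norm_nonneg _)).trans_eq ?_
    simp_rw [norm_indicator_eq_indicator_norm, norm_one]
    rw [integral_indicator_const _ hB, smul_eq_mul, mul_one]
  have huL : u.1 ∈ Lp ℝ ∞ m := by
    refine Lp.mem_Lp_iff_memLp.2 (memLp_top_of_bound u.1.aestronglyMeasurable (volume.real B) ?_)
    filter_upwards [hu] with x hx
    rw [hx]
    exact hθb _
  -- The cutoff is 0 at the origin and 1 for `|t| ≥ a`. The primitive defining `u` vanishes for `|t|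
  -- ≤ a`, whence `u ξ = u`.
  have hφ : LipschitzOnWith a⁻¹.toNNReal (fun t : ℝ => min 1 (a⁻¹ * |t|)) univ := by
    refine LipschitzOnWith.of_dist_le_mul fun x _ y _ => ?_
    rw [Real.coe_toNNReal _ (inv_nonneg.2 ha.le), Real.dist_eq, Real.dist_eq]
    refine (abs_min_sub_min_le_max _ _ _ _).trans ?_
    rw [sub_self, abs_zero, ← mul_sub, abs_mul, abs_of_pos (inv_pos.2 ha)]
    refine max_le (by positivity) ?_
    exact mul_le_mul_of_nonneg_left (abs_abs_sub_abs_le _ _) (inv_nonneg.2 ha.le)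
  set ξ := SobolevClass.comp h (U := univ) (by simp) hφ with hξdef
  have hξ : ∀ᵐ x ∂m, ξ.1 x = min 1 (a⁻¹ * |h.1 x|) := AEEqFun.coeFn_mk _ _
  have hξL : ξ.1 ∈ Lp ℝ ∞ m := by
    refine Lp.mem_Lp_iff_memLp.2 (memLp_top_of_bound ξ.1.aestronglyMeasurable 1 ?_)
    filter_upwards [hξ] with x hx
    rw [hx, Real.norm_eq_abs, abs_of_nonneg (by positivity)]
    exact min_le_left _ _
  have hmul : SobolevClass.mul u ξ huL hξL = u := by
    refine Subtype.ext (AEEqFun.ext ?_)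
    filter_upwards [AEEqFun.coeFn_mul u.1 ξ.1, hu, hξ] with x h1 h2 h3
    refine h1.trans ?_
    rw [Pi.mul_apply]
    rcases le_total |h.1 x| a with hx | hx
    · rw [h2, hθ0 _ hx, zero_mul]
    · rw [h3, min_eq_left, mul_one]
      rwa [← div_eq_inv_mul, le_div_iff₀ ha, one_mul]
  have key := hleib u ξ huL hξL
  rw [hmul] at key
  rw [key, map_add, 𝒜.smul_chi_smul_eq_zero, 𝒜.smul_chi_smul_eq_zero, add_zero]
  · filter_upwards [hξ] with x h1 h2
    have h2' : h.1 x = 0 := h2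
    change ξ.1 x = 0
    rw [h1, h2']
    simp
  · filter_upwards [hu] with x h1 h2
    have h2' : h.1 x = 0 := h2
    change u.1 x = 0
    rw [h1, h2', intervalIntegral.integral_same]

theorem ChainRule.map_mul_self (h : 𝒜.ChainRule L) (f : SobolevClass m)
    (hf : (f : M →ₘ[m] ℝ) ∈ Lp ℝ ∞ m) :
    L (SobolevClass.mul f f hf hf) = (2 : ℝ) • 𝒜.smul ⟨f, hf⟩ (L f) := by
  obtain ⟨A, hA⟩ := exists_ae_abs_le_of_mem_Lp hf
  -- Squaring is Lipschitz only on bounded sets; the open interval contains almost all values of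
  -- `f`.
  have hfU : m (f.1 ⁻¹' (Ioo (-(|A| + 1)) (|A| + 1))ᶜ) = 0 := by
    change ∀ᵐ x ∂m, f.1 x ∈ Ioo (-(|A| + 1)) (|A| + 1)
    filter_upwards [hA] with x hx
    exact abs_lt.1 (by linarith [le_abs_self A])
  have hφ : LipschitzOnWith (2 * (|A| + 1)).toNNReal (fun t : ℝ => t ^ 2)
      (Ioo (-(|A| + 1)) (|A| + 1)) := by
    refine LipschitzOnWith.of_dist_le_mul fun x hx y hy => ?_
    rw [Real.coe_toNNReal _ (by positivity), Real.dist_eq, Real.dist_eq,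
      show x ^ 2 - y ^ 2 = (x + y) * (x - y) by ring, abs_mul]
    refine mul_le_mul_of_nonneg_right (abs_le.2 ⟨?_, ?_⟩) (abs_nonneg _) <;>
      linarith [hx.1, hx.2, hy.1, hy.2]
  have key := (h f).2 _ (fun t => t ^ 2) _ isOpen_Ioo hfU hφ ((2 : ℝ) • ⟨f, hf⟩) (by
    filter_upwards [Lp.coeFn_smul (2 : ℝ) (⟨f, hf⟩ : Lp ℝ ∞ m)] with x hx _
    rw [hx]
    simp)
  rw [map_smul, LinearMap.smul_apply] at key
  rw [← key]
  congr 1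
  refine Subtype.ext (AEEqFun.ext ?_)
  filter_upwards [AEEqFun.coeFn_mul f.1 f.1, AEEqFun.coeFn_mk (fun x => f.1 x ^ 2)
    (aestronglyMeasurable_comp_of_lipschitzOnWith f.1 hfU hφ)] with x h1 h2
  refine h1.trans (Eq.trans ?_ h2.symm)
  rw [Pi.mul_apply, sq]

theorem ChainRule.leibnizRule (h : 𝒜.ChainRule L) : 𝒜.LeibnizRule L := by
  intro f g hf hg
  have h1 := h.map_mul_self f hf
  have h2 := h.map_mul_self g hg
  have h3 := h.map_mul_self (f + g) (add_mem hf hg)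
  have e : SobolevClass.mul (f + g) (f + g) (add_mem hf hg) (add_mem hf hg) =
      SobolevClass.mul f f hf hf + SobolevClass.mul g g hg hg +
        (2 : ℝ) • SobolevClass.mul f g hf hg := by
    refine Subtype.ext ?_
    change (f.1 + g.1) * (f.1 + g.1) = f.1 * f.1 + g.1 * g.1 + (2 : ℝ) • (f.1 * g.1)
    refine AEEqFun.ext ?_
    filter_upwards [AEEqFun.coeFn_mul (f.1 + g.1) (f.1 + g.1), AEEqFun.coeFn_add f.1 g.1,
      AEEqFun.coeFn_add (f.1 * f.1 + g.1 * g.1) ((2 : ℝ) • (f.1 * g.1)),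
      AEEqFun.coeFn_add (f.1 * f.1) (g.1 * g.1), AEEqFun.coeFn_smul (2 : ℝ) (f.1 * g.1),
      AEEqFun.coeFn_mul f.1 f.1, AEEqFun.coeFn_mul g.1 g.1, AEEqFun.coeFn_mul f.1 g.1]
      with x e1 e2 e3 e4 e5 e6 e7 e8
    simp only [e1, e2, e3, e4, e5, e6, e7, e8, Pi.add_apply, Pi.mul_apply, Pi.smul_apply,
      smul_eq_mul]
    ring
  have e' : (⟨(f + g : SobolevClass m), add_mem hf hg⟩ : Lp ℝ ∞ m) = ⟨f, hf⟩ + ⟨g, hg⟩ := rfl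
  rw [e, map_add, map_add, h1, h2, map_smul, e', map_add, map_add, LinearMap.add_apply,
    map_add, map_add] at h3
  have h4 : (2 : ℝ) • L (SobolevClass.mul f g hf hg) =
      (2 : ℝ) • (𝒜.smul ⟨f, hf⟩ (L g) + 𝒜.smul ⟨g, hg⟩ (L f)) := by
    rw [smul_add] at h3 ⊢
    simp only [smul_add] at h3 ⊢
    rw [← sub_eq_zero] at h3 ⊢
    rw [← h3]
    abel
  exact smul_right_injective V (two_ne_zero' ℝ) h4

end LInftyModule

/-! ### The Leibniz rule implies locality -/

namespace LInftyModule

open SobolevClass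

variable {M : Type*} [MetricSpace M] [SecondCountableTopology M] [MeasurableSpace M]
  [BorelSpace M] {m : Measure M} {V : Type*} [NormedAddCommGroup V] [NormedSpace ℝ V]
  [CompleteSpace V] {𝒜 : LInftyModule m V} {L : SobolevClass m →ₗ[ℝ] V} {C : ℝ}

theorem LeibnizRule.localityRule (hleib : 𝒜.LeibnizRule L) (hC : 0 < C)
    (hL : ∀ f : SobolevClass m, ‖L f‖ ≤ C * √(∫ x, minimalWeakUpperGradient m f.1 x ^ 2 ∂m)) :
    𝒜.LocalityRule L := by
  have main : ∀ h : SobolevClass m,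
      𝒜.smul (LInfty.chi m (h.1.measurable (measurableSet_singleton (0 : ℝ)))) (L h) = 0 := by
    intro h
    -- This choice of `G` gives `ν {0} = 0`. The sets `(B n)ᶜ` decrease to a subset of `{0}`, so the
    -- errors `ν (B n)ᶜ` of the truncations tend to 0.
    obtain ⟨G, hG, hG0⟩ := exists_gradientMeasure_eq_zero h (measurableSet_singleton (0 : ℝ))
      (by simp)
    have := isFiniteMeasure_gradientMeasure hG
    set ν := gradientMeasure m h.1 G
    set B : ℕ → Set ℝ := fun n => {t : ℝ | 1 / ((n : ℝ) + 1) < |t| ∧ |t| < (n : ℝ) + 1}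
    have hB : ∀ n, MeasurableSet (B n) := fun n =>
      (measurableSet_lt measurable_const measurable_abs).inter
        (measurableSet_lt measurable_abs measurable_const)
    have hle : ∀ n, ‖𝒜.smul (LInfty.chi m (h.1.measurable (measurableSet_singleton (0 : ℝ))))
        (L h)‖ₑ ^ 2 ≤ ENNReal.ofReal C ^ 2 * ν (B n)ᶜ := by
      intro n
      obtain ⟨u, hu, hu0⟩ := hleib.exists_hasDensity_smul_chi_eq_zero h
        (a := 1 / ((n : ℝ) + 1)) (b := (n : ℝ) + 1) (by positivity)
      rw [← sub_zero (𝒜.smul _ (L h)), ← hu0, ← map_sub, ← map_sub]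
      calc _ ≤ ‖L (h - u)‖ₑ ^ 2 := by
            gcongr
            exact enorm_le_iff_norm_le.2 (𝒜.norm_smul_chi_le _ _)
        _ ≤ _ := ((HasDensity.refl h).sub hu).enorm_sq_le hC hL hG
        _ = _ := by
            rw [← setLIntegral_one, ← lintegral_indicator (hB n).compl]
            congr 1
            refine lintegral_congr fun t => ?_
            change ‖1 - (B n).indicator (fun _ => (1 : ℝ)) t‖ₑ ^ 2 = _
            by_cases ht : t ∈ B n <;> simp [ht]
    have hanti : Antitone fun n => (B n)ᶜ := by
      refine fun n k hnk => compl_subset_compl.2 fun t ht => ?_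
      have hnk' : (n : ℝ) ≤ k := by exact_mod_cast hnk
      exact ⟨(one_div_le_one_div_of_le (by positivity) (by linarith)).trans_lt ht.1,
        ht.2.trans_le (by linarith)⟩
    have hInter : ⋂ n, (B n)ᶜ ⊆ {0} := by
      intro t ht
      by_contra h0
      have hpos : 0 < |t| := abs_pos.2 h0
      obtain ⟨n, hn⟩ := exists_nat_one_div_lt hpos
      obtain ⟨k, hk⟩ := exists_nat_gt |t|
      refine mem_iInter.1 ht (max n k) ⟨lt_of_le_of_lt ?_ hn, hk.trans ?_⟩
      · refine one_div_le_one_div_of_le (by positivity) ?_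
        push_cast
        linarith [le_max_left (n : ℝ) k]
      · push_cast
        linarith [le_max_right (n : ℝ) k]
    have hlim := tendsto_measure_iInter_atTop (μ := ν) (s := fun n => (B n)ᶜ)
      (fun n => (hB n).compl.nullMeasurableSet) hanti ⟨0, measure_ne_top _ _⟩
    rw [measure_mono_null hInter hG0] at hlim
    have := ge_of_tendsto' (ENNReal.Tendsto.const_mul (a := ENNReal.ofReal C ^ 2) hlim
      (Or.inr (by simp))) hle
    simpa using this
  exact localityRule_of_smul_chi_eq_zero main

end LInftyModule

theorem mainTheorem9 {M : Type*} [MetricSpace M] [CompleteSpace M]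
    [TopologicalSpace.SeparableSpace M] [MeasurableSpace M] [BorelSpace M]
    (m : Measure M) [IsLocallyFiniteMeasure m]
    {V : Type*} [NormedAddCommGroup V] [NormedSpace ℝ V] [CompleteSpace V]
    (𝒜 : LInftyModule m V) (L : SobolevClass m →ₗ[ℝ] V)
    (C : ℝ) (hC : 0 < C)
    (hL : ∀ f : SobolevClass m, ‖L f‖ ≤ C * √(∫ x, minimalWeakUpperGradient m f.1 x ^ 2 ∂m)) :
    [𝒜.LeibnizRule L, 𝒜.ChainRule L, 𝒜.LocalityRule L].TFAE := by
  have : SecondCountableTopology M := UniformSpace.secondCountable_of_separable M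
  tfae_have 1 → 3 := fun h => h.localityRule hC hL
  tfae_have 3 → 2 := fun h => h.chainRule hC hL
  tfae_have 2 → 1 := fun h => h.leibnizRule
  tfae_finish
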